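/- Let $k$ be a field. Let $Q=(Q_0,Q_1)$ be an ordered quiver, i.e. a finite quiver without oriented cycles such that for each arrow $\alpha\colon x\to y$ the only oriented path from $x$ to $y$ is $\alpha$ itself. Let $kQ$ be its path algebra, whose basis consists of all oriented paths (including the trivial path $e_x$ at each vertex $x$), with product $pq$ = "first $p$, then $q$" when $p$ ends where $q$ starts and $pq=0$ otherwise. Let $I\subseteq kQ$ be the two-sided ideal generated by the differences of paths having the same initial vertex and the same terminal vertex, and let $A=kQ/I$ be the incidence algebra of $Q$. Let $\overline Q$ be the suspension of $Q$: the quiver obtained from $Q$ by adjoining two new vertices $a$ and $b$, one new arrow from $b$ to each source of $Q$ (a vertex that is not the terminal vertex of any arrow) and one new arrow from each sink of $Q$ (a vertex that is not the initial vertex of any arrow) to $a$. Let $\overline A=k\overline Q/\overline I$ be the incidence algebra of $\overline Q$, defined in the same way. For a vertex $x$ of $\overline Q$ let $k_x$ denote the one-dimensional left $\overline A$-module on which the class of $e_x$ acts as the identity and the class of every other path acts as zero. Then for every integer $n\geq 1$ there is an isomorphism of $k$-vector spaces $$HH^n(A,A)\;\cong\;\operatorname{Ext}^{\,n+2}_{\overline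 A}(k_a,k_b),$$ where $HH^n(A,A)=\operatorname{Ext}^n_{A\otimes_k A^{\mathrm{op}}}(A,A)$ is the Hochschild cohomology of $A$ with coefficients in the bimodule $A$. -/

import Mathlib

open CategoryTheory
open scoped TensorProduct

universe u

/-! ### Ordered quivers -/

/-- An ordered quiver: a finite quiver without oriented cycles in which an arrow is the only
oriented path from its source to its target. -/
class IsOrderedQuiver (V : Type u) [Quiver.{u} V] [Finite V] : Prop where
  finite_arrows : ∀ x y : V, Finite (x ⟶ y)
  acyclic : ∀ (x : V) (p : Quiver.Path x x), p = Quiver.Path.nil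
  path_eq_arrow : ∀ (x y : V) (α : x ⟶ y) (p : Quiver.Path x y), p = α.toPath

/-- A source: a vertex which is not the terminal vertex of any arrow. -/
def IsSourceVertex {V : Type u} [Quiver.{u} V] (x : V) : Prop := ∀ y : V, IsEmpty (y ⟶ x)

/-- A sink: a vertex which is not the initial vertex of any arrow. -/
def IsSinkVertex {V : Type u} [Quiver.{u} V] (x : V) : Prop := ∀ y : V, IsEmpty (x ⟶ y)

/-! ### The path algebra and the incidence algebra of a quiver -/

/-- All oriented paths of a quiver, including the trivial ones: triples `⟨x, y, p⟩` with `p` a path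
from `x` to `y`. -/
abbrev AnyPath (V : Type u) [Quiver.{u} V] : Type u := Σ (x : V) (y : V), Quiver.Path x y

/-- The path algebra `kQ`: the vector space with basis the oriented paths. -/
def PathAlgebra (k : Type u) [Field k] (V : Type u) [Quiver.{u} V] : Type u := AnyPath V →₀ k

namespace PathAlgebra

variable (k : Type u) [Field k] {V : Type u} [Quiver.{u} V]

noncomputable instance : AddCommGroup (PathAlgebra k V) :=
  inferInstanceAs (AddCommGroup (AnyPath V →₀ k))

noncomputable instance : Module k (PathAlgebra k V) :=
  inferInstanceAs (Module k (AnyPath V →₀ k))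

/-- The basis element given by a path. -/
noncomputable def ofPath {x y : V} (p : Quiver.Path x y) : PathAlgebra k V :=
  Finsupp.single (⟨x, y, p⟩ : AnyPath V) 1

open Classical in
/-- The product of two basis elements: the concatenation "first `p`, then `q`" if `p` ends where
`q` starts, and `0` otherwise. -/
noncomputable def pathMul (p q : AnyPath V) : PathAlgebra k V :=
  if h : q.1 = p.2.1 then ofPath k (p.2.2.comp (q.2.2.cast h rfl)) else 0

/-- The bilinear extension of the product of paths. -/
noncomputable def mulBilin : PathAlgebra k V →ₗ[k] PathAlgebra k V →ₗ[k] PathAlgebra k V :=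
  Finsupp.linearCombination k fun p : AnyPath V => Finsupp.linearCombination k (pathMul k p)

noncomputable instance : Mul (PathAlgebra k V) := ⟨fun f g => mulBilin k f g⟩

/-- The unit is the sum of the trivial paths (a finite sum when `V` is finite). -/
noncomputable instance : One (PathAlgebra k V) :=
  ⟨∑ᶠ x : V, ofPath k (Quiver.Path.nil : Quiver.Path x x)⟩

theorem mul_def (f g : PathAlgebra k V) : f * g = mulBilin k f g := rfl

theorem mulBilin_ofPath {x y z w : V} (p : Quiver.Path x y) (q : Quiver.Path z w) :
    mulBilin k (ofPath k p) (ofPath k q) = pathMul k ⟨x, y, p⟩ ⟨z, w, q⟩ := by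
  unfold mulBilin ofPath
  erw [Finsupp.linearCombination_single, one_smul, Finsupp.linearCombination_single, one_smul]

theorem ofPath_mul_ofPath {x y z : V} (p : Quiver.Path x y) (q : Quiver.Path y z) :
    ofPath k p * ofPath k q = ofPath k (p.comp q) := by
  rw [mul_def, mulBilin_ofPath, pathMul, dif_pos rfl]
  rfl

theorem ofPath_mul_ofPath_of_ne {x y z w : V} (p : Quiver.Path x y) (q : Quiver.Path z w)
    (h : z ≠ y) : ofPath k p * ofPath k q = 0 := by
  rw [mul_def, mulBilin_ofPath, pathMul, dif_neg h]

/-- Linear maps out of the path algebra agree if they agree on paths. -/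
theorem hom_ext {M : Type*} [AddCommGroup M] [Module k M] {f g : PathAlgebra k V →ₗ[k] M}
    (h : ∀ (x y : V) (p : Quiver.Path x y), f (ofPath k p) = g (ofPath k p)) : f = g :=
  Finsupp.lhom_ext' fun ⟨x, y, p⟩ => LinearMap.ext_ring (h x y p)

theorem ofPath_mul_assoc {x y z w s t : V} (p : Quiver.Path x y) (q : Quiver.Path z w)
    (r : Quiver.Path s t) :
    ofPath k p * ofPath k q * ofPath k r = ofPath k p * (ofPath k q * ofPath k r) := by
  have h0 (f : PathAlgebra k V) : 0 * f = 0 := LinearMap.congr_fun (map_zero (mulBilin k)) f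
  have h0' (f : PathAlgebra k V) : f * 0 = 0 := map_zero (mulBilin k f)
  by_cases h1 : z = y
  · subst h1
    by_cases h2 : s = w
    · subst h2
      simp only [ofPath_mul_ofPath, Quiver.Path.comp_assoc]
    · rw [ofPath_mul_ofPath, ofPath_mul_ofPath_of_ne k _ _ h2, ofPath_mul_ofPath_of_ne k _ _ h2, h0']
  · rw [ofPath_mul_ofPath_of_ne k _ _ h1, h0]
    by_cases h2 : s = w
    · subst h2
      rw [ofPath_mul_ofPath, ofPath_mul_ofPath_of_ne k _ _ h1]
    · rw [ofPath_mul_ofPath_of_ne k _ _ h2, h0']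

theorem mul_assoc_aux (f g h : PathAlgebra k V) : f * g * h = f * (g * h) := by
  have H1 {x y z w : V} (p : Quiver.Path x y) (q : Quiver.Path z w) :
      mulBilin k (ofPath k p * ofPath k q) = mulBilin k (ofPath k p) ∘ₗ mulBilin k (ofPath k q) :=
    hom_ext k fun _ _ r => ofPath_mul_assoc k p q r
  have H2 {x y : V} (p : Quiver.Path x y) :
      (mulBilin k).flip h ∘ₗ mulBilin k (ofPath k p) =
        mulBilin k (ofPath k p) ∘ₗ (mulBilin k).flip h :=
    hom_ext k fun _ _ q => LinearMap.congr_fun (H1 p q) h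
  have H3 : (mulBilin k).flip h ∘ₗ (mulBilin k).flip g = (mulBilin k).flip (g * h) :=
    hom_ext k fun _ _ p => LinearMap.congr_fun (H2 p) g
  exact LinearMap.congr_fun H3 f

theorem one_def [Fintype V] :
    (1 : PathAlgebra k V) = ∑ x : V, ofPath k (Quiver.Path.nil : Quiver.Path x x) :=
  finsum_eq_sum_of_fintype _

theorem one_mul_aux [Finite V] (f : PathAlgebra k V) : 1 * f = f := by
  classical
  have := Fintype.ofFinite V
  have H : mulBilin k (1 : PathAlgebra k V) = LinearMap.id := by
    refine hom_ext k fun x y p => ?_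
    rw [one_def, map_sum, LinearMap.sum_apply, Finset.sum_eq_single x]
    · rw [← mul_def, ofPath_mul_ofPath, Quiver.Path.nil_comp, LinearMap.id_apply]
    · intro z _ hz
      rw [← mul_def, ofPath_mul_ofPath_of_ne k _ _ hz.symm]
    · exact fun h => absurd (Finset.mem_univ x) h
  exact LinearMap.congr_fun H f

theorem mul_one_aux [Finite V] (f : PathAlgebra k V) : f * 1 = f := by
  classical
  have := Fintype.ofFinite V
  have H : (mulBilin k).flip (1 : PathAlgebra k V) = LinearMap.id := by
    refine hom_ext k fun x y p => ?_
    rw [one_def, map_sum, LinearMap.sum_apply, Finset.sum_eq_single y]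
    · rw [LinearMap.flip_apply, ← mul_def, ofPath_mul_ofPath, Quiver.Path.comp_nil,
        LinearMap.id_apply]
    · intro z _ hz
      rw [LinearMap.flip_apply, ← mul_def, ofPath_mul_ofPath_of_ne k _ _ hz]
    · exact fun h => absurd (Finset.mem_univ y) h
  exact LinearMap.congr_fun H f

noncomputable instance [Finite V] : Ring (PathAlgebra k V) where
  __ := (inferInstance : AddCommGroup (PathAlgebra k V))
  mul_assoc := mul_assoc_aux k
  one_mul := one_mul_aux k
  mul_one := mul_one_aux k
  left_distrib f g h := map_add (mulBilin k f) g h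
  right_distrib f g h := LinearMap.congr_fun (map_add (mulBilin k) f g) h
  zero_mul f := LinearMap.congr_fun (map_zero (mulBilin k)) f
  mul_zero f := map_zero (mulBilin k f)

noncomputable instance [Finite V] : Algebra k (PathAlgebra k V) :=
  Algebra.ofModule
    (fun c f g => LinearMap.congr_fun (map_smul (mulBilin k) c f) g)
    (fun c f g => (map_smul (mulBilin k f) c g : _))

end PathAlgebra

/-- The parallel ideal `I` of `kQ`: the two-sided ideal generated by the differences of paths with
the same initial and the same terminal vertex. -/
noncomputable def parallelIdeal (k : Type u) [Field k] (V : Type u) [Quiver.{u} V] [Finite V] :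
    TwoSidedIdeal (PathAlgebra k V) :=
  TwoSidedIdeal.span
    {f | ∃ (x y : V) (p q : Quiver.Path x y), f = PathAlgebra.ofPath k p - PathAlgebra.ofPath k q}

/-- The incidence algebra `kQ / I` of a quiver. -/
abbrev QuiverIncidenceAlgebra (k : Type u) [Field k] (V : Type u) [Quiver.{u} V] [Finite V] :
    Type u :=
  (parallelIdeal k V).ringCon.Quotient

/-! ### The one-dimensional modules at the vertices -/

section Simple

variable (k : Type u) [Field k] {V : Type u} [Quiver.{u} V]

open Classical in
/-- The linear functional on `kQ` which is `1` on the trivial path at `x` and `0` on every other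
path. -/
noncomputable def vertexFunctional (x : V) : PathAlgebra k V →ₗ[k] k :=
  Finsupp.linearCombination k fun p : AnyPath V =>
    if p = ⟨x, x, Quiver.Path.nil⟩ then (1 : k) else 0

open Classical in
theorem vertexFunctional_ofPath (x : V) {y z : V} (p : Quiver.Path y z) :
    vertexFunctional k x (PathAlgebra.ofPath k p) =
      if (⟨y, z, p⟩ : AnyPath V) = ⟨x, x, Quiver.Path.nil⟩ then (1 : k) else 0 := by
  unfold vertexFunctional PathAlgebra.ofPath
  erw [Finsupp.linearCombination_single, one_smul]

theorem vertexFunctional_nil (x : V) :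
    vertexFunctional k x (PathAlgebra.ofPath k (Quiver.Path.nil : Quiver.Path x x)) = 1 := by
  rw [vertexFunctional_ofPath, if_pos rfl]

variable [Finite V]

/-- `vertexFunctional` is multiplicative: a concatenation is a trivial path only if both paths
are. -/
noncomputable def vertexCharacter (x : V) : PathAlgebra k V →ₐ[k] k :=
  AlgHom.ofLinearMap (vertexFunctional k x)
    (by
      classical
      have := Fintype.ofFinite V
      rw [PathAlgebra.one_def, map_sum, Finset.sum_eq_single x]
      · exact vertexFunctional_nil k x
      · intro z _ hz
        rw [vertexFunctional_ofPath, if_neg]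
        exact fun h => hz (congrArg Sigma.fst h)
      · exact fun h => absurd (Finset.mem_univ x) h)
    (by
      classical
      have key {y z s t : V} (p : Quiver.Path y z) (q : Quiver.Path s t) :
          vertexFunctional k x (PathAlgebra.ofPath k p * PathAlgebra.ofPath k q) =
            vertexFunctional k x (PathAlgebra.ofPath k p) *
              vertexFunctional k x (PathAlgebra.ofPath k q) := by
        by_cases hsz : s = z
        · subst hsz
          rw [PathAlgebra.ofPath_mul_ofPath]
          simp only [vertexFunctional_ofPath]
          cases q with
          | nil =>
            rw [Quiver.Path.comp_nil]
            by_cases h : (⟨y, s, p⟩ : AnyPath V) = ⟨x, x, Quiver.Path.nil⟩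
            · have hs : s = x := congrArg (fun r : AnyPath V => r.2.1) h
              subst hs
              simp
            · rw [if_neg h, zero_mul]
          | cons q α =>
            have hne {s t u : V} (r : Quiver.Path s t) (β : t ⟶ u) :
                (⟨s, u, r.cons β⟩ : AnyPath V) ≠ ⟨x, x, Quiver.Path.nil⟩ := by
              intro h
              have := congrArg (fun r : AnyPath V => r.2.2.length) h
              simp at this
            rw [Quiver.Path.comp_cons, if_neg (hne _ _), if_neg (hne _ _), mul_zero]
        · rw [PathAlgebra.ofPath_mul_ofPath_of_ne k _ _ hsz, map_zero]
          simp only [vertexFunctional_ofPath]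
          by_cases h : (⟨y, z, p⟩ : AnyPath V) = ⟨x, x, Quiver.Path.nil⟩
          · rw [if_neg (c := (⟨s, t, q⟩ : AnyPath V) = _), mul_zero]
            intro h'
            exact hsz ((congrArg Sigma.fst h').trans
              (congrArg (fun r : AnyPath V => r.2.1) h).symm)
          · rw [if_neg h, zero_mul]
      have H1 {y z : V} (p : Quiver.Path y z) :
          vertexFunctional k x ∘ₗ LinearMap.mulLeft k (PathAlgebra.ofPath k p) =
            vertexFunctional k x (PathAlgebra.ofPath k p) • vertexFunctional k x :=
        PathAlgebra.hom_ext k fun _ _ q => key p q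
      intro f g
      have H2 : vertexFunctional k x ∘ₗ LinearMap.mulRight k g =
            LinearMap.mulRight k (vertexFunctional k x g) ∘ₗ vertexFunctional k x :=
        PathAlgebra.hom_ext k fun _ _ p => LinearMap.congr_fun (H1 p) g
      exact LinearMap.congr_fun H2 f)

variable [IsOrderedQuiver V]

/-- The character of the incidence algebra which is `1` on the class of the trivial path at `x`
and `0` on the class of every other path. -/
noncomputable def incidenceCharacter (x : V) : QuiverIncidenceAlgebra k V →ₐ[k] k :=
  (parallelIdeal k V).ringCon.liftₐ (vertexCharacter k x) <| by
    classical
    have key {y z : V} (p q : Quiver.Path y z)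
        (hp : (⟨y, z, p⟩ : AnyPath V) = ⟨x, x, Quiver.Path.nil⟩) :
        (⟨y, z, q⟩ : AnyPath V) = ⟨x, x, Quiver.Path.nil⟩ := by
      have hy : y = x := congrArg Sigma.fst hp
      have hz : z = x := congrArg (fun r : AnyPath V => r.2.1) hp
      subst hy
      subst hz
      rw [IsOrderedQuiver.acyclic z q]
    have h : parallelIdeal k V ≤ TwoSidedIdeal.ker (vertexCharacter k x).toRingHom := by
      refine TwoSidedIdeal.span_le.2 ?_
      rintro _ ⟨y, z, p, q, rfl⟩
      refine (TwoSidedIdeal.mem_ker _).2 ?_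
      change vertexFunctional k x (_ - _) = 0
      rw [map_sub, sub_eq_zero, vertexFunctional_ofPath, vertexFunctional_ofPath]
      exact if_congr ⟨key p q, key q p⟩ rfl rfl
    exact TwoSidedIdeal.ringCon_le_iff.1 h

open Classical in
theorem incidenceCharacter_mk_ofPath (x : V) {y z : V} (p : Quiver.Path y z) :
    incidenceCharacter k x ((parallelIdeal k V).ringCon.mk' (PathAlgebra.ofPath k p)) =
      if (⟨y, z, p⟩ : AnyPath V) = ⟨x, x, Quiver.Path.nil⟩ then (1 : k) else 0 :=
  vertexFunctional_ofPath k x p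

/-- The one-dimensional left module `ₓk` of the incidence algebra: the class of the trivial path at
`x` acts as the identity, the class of every other path acts as zero. -/
noncomputable abbrev simpleModule (x : V) : ModuleCat.{u} (QuiverIncidenceAlgebra k V) :=
  (ModuleCat.restrictScalars (incidenceCharacter k x).toRingHom).obj (ModuleCat.of k k)

end Simple

/-! ### The suspension of a quiver -/

/-- The vertices of the suspension: those of the quiver and two new vertices `a` and `b`. -/
inductive Suspension (V : Type u) : Type u
  | of (x : V) : Suspension V
  | a : Suspension V
  | b : Suspension V

/-- The arrows of the suspension: those of the quiver, an arrow from `b` to each source and an arrow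
from each sink to `a`. -/
inductive Suspension.Arrow {V : Type u} [Quiver.{u} V] : Suspension V → Suspension V → Type u
  | of {x y : V} (α : x ⟶ y) : Suspension.Arrow (Suspension.of x) (Suspension.of y)
  | toSource (x : V) (hx : IsSourceVertex x) : Suspension.Arrow Suspension.b (Suspension.of x)
  | fromSink (x : V) (hx : IsSinkVertex x) : Suspension.Arrow (Suspension.of x) Suspension.a

namespace Suspension

variable {V : Type u}

instance [Quiver.{u} V] : Quiver.{u} (Suspension V) := ⟨Suspension.Arrow⟩

instance [Finite V] : Finite (Suspension V) := by
  refine Finite.of_surjective (fun o : Option (Option V) => match o with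
    | none => Suspension.a
    | some none => Suspension.b
    | some (some x) => Suspension.of x) ?_
  rintro (x | _ | _)
  · exact ⟨some (some x), rfl⟩
  · exact ⟨none, rfl⟩
  · exact ⟨some none, rfl⟩

variable [Quiver.{u} V]

/-- The inclusion of the quiver in its suspension. -/
def inclusion : V ⥤q Suspension V where
  obj := Suspension.of
  map := Suspension.Arrow.of

theorem path_of {x : V} {v : Suspension V} (p : Quiver.Path (Suspension.of x) v) :
    match v, p with
    | .of y, p => ∃ q : Quiver.Path x y, p = inclusion.mapPath q
    | .a, _ => True
    | .b, _ => False := by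
  induction p with
  | nil => exact ⟨Quiver.Path.nil, rfl⟩
  | cons p e ih =>
    change Suspension.Arrow _ _ at e
    cases e with
    | of α =>
      obtain ⟨q, rfl⟩ := ih
      exact ⟨q.cons α, rfl⟩
    | toSource x hx =>
      change False at ih
      exact ih.elim
    | fromSink x hx => trivial

theorem path_a {v : Suspension V} (p : Quiver.Path Suspension.a v) :
    v = Suspension.a ∧ p.length = 0 := by
  induction p with
  | nil => exact ⟨rfl, rfl⟩
  | cons p e ih =>
    obtain ⟨rfl, -⟩ := ih
    change Suspension.Arrow _ _ at e
    cases e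

theorem path_b {v : Suspension V} (p : Quiver.Path v Suspension.b) : p.length = 0 := by
  cases p with
  | nil => rfl
  | cons p e =>
    change Suspension.Arrow _ _ at e
    cases e

theorem path_sink {x y : V} (hx : IsSinkVertex x) (p : Quiver.Path x y) :
    y = x ∧ p.length = 0 := by
  induction p with
  | nil => exact ⟨rfl, rfl⟩
  | cons p e ih =>
    obtain ⟨rfl, -⟩ := ih
    exact ((hx _).false e).elim

/-- The suspension of an ordered quiver is an ordered quiver. -/
instance [Finite V] [IsOrderedQuiver V] : IsOrderedQuiver (Suspension V) where
  finite_arrows := by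
    rintro (x | _ | _) (y | _ | _)
    · have := IsOrderedQuiver.finite_arrows x y
      refine Finite.of_surjective (fun α : x ⟶ y => (Suspension.Arrow.of α : _)) ?_
      rintro ⟨α⟩
      exact ⟨α, rfl⟩
    all_goals
      refine @Finite.of_subsingleton _ ⟨?_⟩
      rintro ⟨⟩ ⟨⟩
      try rfl
  acyclic := by
    rintro (x | _ | _) p
    · obtain ⟨q, rfl⟩ := path_of p
      rw [IsOrderedQuiver.acyclic x q]
      rfl
    · exact Quiver.Path.eq_nil_of_length_zero p (path_a p).2
    · exact Quiver.Path.eq_nil_of_length_zero p (path_b p)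
  path_eq_arrow := by
    intro x y e p
    change Suspension.Arrow _ _ at e
    cases e with
    | of α =>
      obtain ⟨q, rfl⟩ := path_of p
      rw [IsOrderedQuiver.path_eq_arrow _ _ α q]
      rfl
    | toSource x hx =>
      cases p with
      | cons p e =>
        change Suspension.Arrow _ _ at e
        cases e with
        | of β => exact ((hx _).false β).elim
        | toSource _ _ =>
          rw [Quiver.Path.eq_nil_of_length_zero p (path_b p)]
          rfl
    | fromSink x hx =>
      cases p with
      | cons p e =>
        change Suspension.Arrow _ _ at e
        cases e with
        | fromSink y hy =>
          obtain ⟨q, rfl⟩ := path_of p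
          obtain ⟨rfl, hq⟩ := path_sink hx q
          rw [Quiver.Path.eq_nil_of_length_zero q hq]
          rfl

end Suspension

/-! ### Hochschild cohomology -/

section Hochschild

variable (k : Type u) [Field k] (A : Type u) [Ring A] [Algebra k A]

/-- The bimodule `A`, as a left module over the enveloping algebra `A ⊗ Aᵒᵖ`: `a ⊗ b` acts by
`x ↦ a * x * b`. -/
noncomputable abbrev regularBimodule : ModuleCat.{u} (A ⊗[k] Aᵐᵒᵖ) :=
  letI : Module (A ⊗[k] Aᵐᵒᵖ) A := instModuleTensorProductMop k A
  ModuleCat.of (A ⊗[k] Aᵐᵒᵖ) A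

/-- The Hochschild cohomology `HHⁿ(A, M)` of a `k`-algebra with coefficients in a bimodule, defined
(as usual over a field `k`) as `Extⁿ(A, M)` over the enveloping algebra. -/
abbrev HochschildCohomology (M : ModuleCat.{u} (A ⊗[k] Aᵐᵒᵖ)) (n : ℕ) : Type u :=
  Abelian.Ext (regularBimodule k A) M n

end Hochschild

/-! Both groups are the cohomology of one simplicial complex: the order complex of the poset in
which `x ≤ y` means that there is a path from `x` to `y`. Acyclicity makes this a partial order, and
identifying parallel paths leaves one basis element of the algebra for each relation, multiplying
like matrix units. `IncidenceData` records exactly this. The enveloping algebra is again of this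
type, for the poset `V × Vᵒᵈ` (`IncidenceData.enveloping`), so one construction serves both Ext
groups.

The construction resolves modules by chains. To a vertex `z` attach the formal combinations of
strictly increasing lists with entries in a set `S z` that shrinks as `z` grows. Deleting entries
with alternating signs gives a complex, and if `S z` has a least element, putting it in front of a
list is a contracting homotopy (`listCone_homotopy`). When each list `l` occurs exactly at the
vertices below some vertex `t l`, the terms are projective (`projective_rep_supported`), and maps
from them to the module that is `k` on a lower set `W` and zero elsewhere are the functions on the
lists with `t l ∈ W` (`cochainHom_bijective`).

For Hochschild cohomology, `S (u, v)` is the interval `[u, v]`, and the lists of length at least one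
resolve the bimodule `A`, which is `k` on the pairs `u ≤ v`. Every chain contributes to the
cochains, so the cochain complex is that of the order complex.

For the suspension, `S z` is `[z, a)`. The lists of all lengths resolve `k_a`, because among the
vertices below `a` only `z = a` has an empty interval. Maps to `k_b` see only the lists starting
with `b`, that is, `b` followed by a chain of `V`. An `i`-simplex has `i + 1` entries, so it gives a
list of length `i + 2`, which sits in degree `i + 2`: this is the shift by two. The extra entry `b`
changes the coboundary only by the sign `-1`, which does not affect the cohomology. -/

/-! ### Ext groups from exact sequences of projective objects -/

namespace CategoryTheory

open Limits Abelian

section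

universe w v u'

variable {C : Type u'} [Category.{v} C] [Abelian C]

/-- An exact sequence `⋯ ⟶ P 1 ⟶ P 0 ⟶ X ⟶ 0` of projective objects, as a projective
resolution. -/
noncomputable def ProjectiveResolution.ofExactSequence {X : C} (P : ℕ → C)
    [∀ n, Projective (P n)] (d : ∀ n, P (n + 1) ⟶ P n) (π : P 0 ⟶ X) [Epi π]
    (hd : ∀ n, d (n + 1) ≫ d n = 0) (hπ : d 0 ≫ π = 0)
    (exact : ∀ n, (ShortComplex.mk _ _ (hd n)).Exact)
    (exact₀ : (ShortComplex.mk _ _ hπ).Exact) : ProjectiveResolution X where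
  complex := ChainComplex.of P d hd
  projective n := inferInstanceAs (Projective (P n))
  π := (ChainComplex.toSingle₀Equiv _ _).symm
    ⟨π, (congrArg (· ≫ π) (ChainComplex.of_d P d 0)).trans hπ⟩
  quasiIso := ⟨fun n => by
    cases n
    · rw [ChainComplex.quasiIsoAt₀_iff, ShortComplex.quasiIso_iff_of_zeros']
      · refine (ShortComplex.exact_and_epi_g_iff_of_iso ?_).2 ⟨exact₀, by dsimp; infer_instance⟩
        exact ShortComplex.isoMk (Iso.refl _) (Iso.refl _) (Iso.refl _)
          ((Category.id_comp _).trans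
            ((ChainComplex.of_d P d 0).symm.trans (Category.comp_id _).symm))
          ((Category.id_comp _).trans
            ((ChainComplex.toSingle₀Equiv_symm_apply_f_zero (C := ChainComplex.of P d hd) π
              ((congrArg (· ≫ π) (ChainComplex.of_d P d 0)).trans hπ)).symm.trans
              (Category.comp_id _).symm))
      all_goals rfl
    · rename_i n
      rw [quasiIsoAt_iff_exactAt']
      · rw [HomologicalComplex.exactAt_iff' _ (n + 2) (n + 1) n (by simp) (by simp)]
        refine (ShortComplex.exact_iff_of_iso ?_).2 (exact n)
        exact ShortComplex.isoMk (Iso.refl _) (Iso.refl _) (Iso.refl _)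
          ((Category.id_comp _).trans
            ((ChainComplex.of_d P d (n + 1)).symm.trans (Category.comp_id _).symm))
          ((Category.id_comp _).trans
            ((ChainComplex.of_d P d n).symm.trans (Category.comp_id _).symm))
      · apply ChainComplex.exactAt_succ_single_obj⟩

theorem ProjectiveResolution.ofExactSequence_d {X : C} (P : ℕ → C)
    [∀ n, Projective (P n)] (d : ∀ n, P (n + 1) ⟶ P n) (π : P 0 ⟶ X) [Epi π]
    (hd : ∀ n, d (n + 1) ≫ d n = 0) (hπ : d 0 ≫ π = 0)
    (exact : ∀ n, (ShortComplex.mk _ _ (hd n)).Exact)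
    (exact₀ : (ShortComplex.mk _ _ hπ).Exact) (n : ℕ) :
    (ProjectiveResolution.ofExactSequence P d π hd hπ exact exact₀).complex.d (n + 1) n = d n :=
  ChainComplex.of_d P d n

variable {k : Type*} [CommRing k] [Linear k C] [HasExt.{w} C]

theorem ProjectiveResolution.smul_extMk {X Y : C} (R : ProjectiveResolution X) {n : ℕ}
    (c : k) (f : R.complex.X n ⟶ Y) (m : ℕ) (hm : n + 1 = m) (hf : R.complex.d m n ≫ f = 0) :
    R.extMk (c • f) m hm (by rw [Linear.comp_smul, hf, smul_zero]) = c • R.extMk f m hm hf := by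
  rw [Ext.smul_eq_comp_mk₀, R.extMk_comp_mk₀]
  congr 1
  simp

/-- `Ext` in positive degrees is the cohomology of any complex isomorphic to the complex of
morphisms out of a projective resolution. -/
theorem ProjectiveResolution.nonempty_ext_linearEquiv {X Y : C} (R : ProjectiveResolution X)
    (n : ℕ) {D₀ D₁ D₂ : Type*} [AddCommGroup D₀] [AddCommGroup D₁] [AddCommGroup D₂]
    [Module k D₀] [Module k D₁] [Module k D₂] (δ₀ : D₀ →ₗ[k] D₁) (δ₁ : D₁ →ₗ[k] D₂)
    (e₀ : D₀ ≃ₗ[k] (R.complex.X n ⟶ Y)) (e₁ : D₁ ≃ₗ[k] (R.complex.X (n + 1) ⟶ Y))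
    (e₂ : D₂ ≃ₗ[k] (R.complex.X (n + 2) ⟶ Y))
    (h₀ : ∀ x, e₁ (δ₀ x) = R.complex.d (n + 1) n ≫ e₀ x)
    (h₁ : ∀ x, e₂ (δ₁ x) = R.complex.d (n + 2) (n + 1) ≫ e₁ x) :
    Nonempty ((LinearMap.ker δ₁ ⧸ (LinearMap.range δ₀).submoduleOf (LinearMap.ker δ₁)) ≃ₗ[k]
      Ext.{w} X Y (n + 1)) := by
  have hker (x : LinearMap.ker δ₁) : R.complex.d (n + 2) (n + 1) ≫ e₁ x = 0 := by
    rw [← h₁, x.2, map_zero]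
  let Ψ : LinearMap.ker δ₁ →ₗ[k] Ext.{w} X Y (n + 1) :=
    { toFun x := R.extMk (e₁ x) (n + 2) rfl (hker x)
      map_add' x y := by
        rw [R.add_extMk]
        congr 1
        exact map_add e₁ _ _
      map_smul' c x := by
        rw [RingHom.id_apply, ← R.smul_extMk]
        congr 1
        exact map_smul e₁ _ _ }
  have hΨ : Function.Surjective Ψ := by
    intro α
    obtain ⟨f, hf, rfl⟩ := R.extMk_surjective α (n + 2) rfl
    obtain ⟨x, rfl⟩ := e₁.surjective f
    exact ⟨⟨x, e₂.injective (by rw [h₁, hf, map_zero])⟩, rfl⟩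
  -- A cocycle has trivial class exactly when it factors through the preceding differential; through
  -- `e₀` and `e₁` this says that it is a coboundary.
  have hΨker : LinearMap.ker Ψ = (LinearMap.range δ₀).submoduleOf (LinearMap.ker δ₁) := by
    ext x
    rw [LinearMap.mem_ker]
    refine (R.extMk_eq_zero_iff (e₁ x) (n + 2) rfl (hker x) n rfl).trans ⟨?_, ?_⟩
    · rintro ⟨g, hg⟩
      obtain ⟨y, rfl⟩ := e₀.surjective g
      exact ⟨y, e₁.injective (by rw [h₀, hg]; rfl)⟩
    · rintro ⟨y, hy⟩
      exact ⟨e₀ y, by rw [← h₀, hy]; rfl⟩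
  exact ⟨(Submodule.quotEquivOfEq _ _ hΨker).symm ≪≫ₗ Ψ.quotKerEquivOfSurjective hΨ⟩

end

end CategoryTheory

/-! ### The chain complex of sorted lists -/

section ListComplex

variable (k : Type*) [Field k] {X : Type*}

/-- The alternating sum of the lists obtained by deleting one entry. -/
noncomputable def listBoundaryAux : List X → (List X →₀ k)
  | [] => 0
  | x :: l => Finsupp.single l 1 - Finsupp.lmapDomain k k (List.cons x) (listBoundaryAux l)

/-- The boundary map on formal linear combinations of lists. -/
noncomputable def listBoundary : (List X →₀ k) →ₗ[k] (List X →₀ k) :=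
  Finsupp.linearCombination k (listBoundaryAux k)

theorem listBoundary_single (l : List X) :
    listBoundary k (Finsupp.single l 1) = listBoundaryAux k l := by
  simp [listBoundary]

theorem listBoundary_single_nil : listBoundary k (Finsupp.single ([] : List X) 1) = 0 :=
  listBoundary_single k []

theorem listBoundary_single_cons (x : X) (l : List X) :
    listBoundary k (Finsupp.single (x :: l) 1) = Finsupp.single l 1 -
      Finsupp.lmapDomain k k (List.cons x) (listBoundary k (Finsupp.single l 1)) := by
  rw [listBoundary_single, listBoundary_single, listBoundaryAux]

/-- Think of `x :: l` as the cone over `l` with apex `x`: its boundary is the base minus the cone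
over the boundary of the base. No order is involved yet. -/
theorem listBoundary_cons (x : X) (h : List X →₀ k) :
    listBoundary k (Finsupp.lmapDomain k k (List.cons x) h) =
      h - Finsupp.lmapDomain k k (List.cons x) (listBoundary k h) := by
  have : listBoundary k ∘ₗ Finsupp.lmapDomain k k (List.cons x) =
      LinearMap.id - Finsupp.lmapDomain k k (List.cons x) ∘ₗ listBoundary k := by
    refine Finsupp.lhom_ext' fun l => LinearMap.ext_ring ?_
    simpa using listBoundary_single_cons k x l
  exact LinearMap.congr_fun this h

/-- Induction by the cone formula: the boundary of `l - x·∂l` is `∂l - (∂l - x·∂∂l) = x·∂∂l`. -/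
theorem listBoundary_listBoundary (h : List X →₀ k) : listBoundary k (listBoundary k h) = 0 := by
  have : listBoundary k ∘ₗ listBoundary k = (0 : (List X →₀ k) →ₗ[k] (List X →₀ k)) := by
    refine Finsupp.lhom_ext' fun l => LinearMap.ext_ring ?_
    change listBoundary k (listBoundary k (Finsupp.single l 1)) = 0
    induction l with
    | nil => rw [listBoundary_single_nil, map_zero]
    | cons x l ih => rw [listBoundary_single_cons, map_sub, listBoundary_cons, ih]; simp
  exact LinearMap.congr_fun this h

theorem listBoundary_single_mem (l : List X) :
    listBoundary k (Finsupp.single l 1) ∈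
      Finsupp.supported k k {l' | l'.Sublist l ∧ l'.length + 1 = l.length} := by
  induction l with
  | nil => rw [listBoundary_single_nil]; exact zero_mem _
  | cons x l ih =>
    rw [listBoundary_single_cons]
    refine sub_mem (Finsupp.single_mem_supported k 1 ⟨List.sublist_cons_self x l, rfl⟩) ?_
    have := Submodule.mem_map_of_mem (f := Finsupp.lmapDomain k k (List.cons x)) ih
    rw [Finsupp.lmapDomain_supported] at this
    refine Finsupp.supported_mono ?_ this
    rintro _ ⟨l', h, rfl⟩
    exact ⟨h.1.cons_cons x, by simpa using h.2⟩

open Classical in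
/-- The contraction which puts `u` in front of the lists not starting with `u`. -/
noncomputable def listCone (u : X) : (List X →₀ k) →ₗ[k] (List X →₀ k) :=
  Finsupp.linearCombination k fun l =>
    if l.head? = some u then 0 else Finsupp.single (u :: l) 1

theorem listCone_single_of_head {u : X} {l : List X} (h : l.head? = some u) :
    listCone k u (Finsupp.single l 1) = 0 := by
  simp [listCone, h]

theorem listCone_single {u : X} {l : List X} (h : l.head? ≠ some u) :
    listCone k u (Finsupp.single l 1) = Finsupp.single (u :: l) 1 := by
  simp [listCone, h]

theorem listCone_of_mem_supported {u : X} {h : List X →₀ k}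
    (hh : h ∈ Finsupp.supported k k {l : List X | u ∉ l}) :
    listCone k u h = Finsupp.lmapDomain k k (List.cons u) h := by
  rw [Finsupp.supported_eq_span_single] at hh
  refine LinearMap.eqOn_span ?_ hh
  rintro _ ⟨l, hl, rfl⟩
  rw [listCone_single]
  · simp
  · exact fun h => hl (List.mem_of_mem_head? h)

theorem listCone_cons (u : X) (h : List X →₀ k) :
    listCone k u (Finsupp.lmapDomain k k (List.cons u) h) = 0 := by
  have : listCone k u ∘ₗ Finsupp.lmapDomain k k (List.cons u) = 0 := by
    refine Finsupp.lhom_ext' fun l => LinearMap.ext_ring ?_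
    simpa using listCone_single_of_head k (u := u) (l := u :: l) rfl
  exact LinearMap.congr_fun this h

variable [PartialOrder X]

/-- The sorted lists of a given length with entries in a set. -/
def sortedLists (S : Set X) (n : ℕ) : Set (List X) :=
  {l | l.length = n ∧ l.Pairwise (· < ·) ∧ ∀ x ∈ l, x ∈ S}

theorem sortedLists_mono {S T : Set X} (h : S ⊆ T) (n : ℕ) : sortedLists S n ⊆ sortedLists T n :=
  fun _ hl => ⟨hl.1, hl.2.1, fun x hx => h (hl.2.2 x hx)⟩

theorem listBoundary_mem_supported {S : Set X} {n : ℕ} {h : List X →₀ k}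
    (hh : h ∈ Finsupp.supported k k (sortedLists S (n + 1))) :
    listBoundary k h ∈ Finsupp.supported k k (sortedLists S n) := by
  rw [Finsupp.supported_eq_span_single] at hh
  refine (Submodule.span_le (p := (Finsupp.supported k k _).comap (listBoundary k))).2 ?_ hh
  rintro _ ⟨l, hl, rfl⟩
  refine Finsupp.supported_mono ?_ (listBoundary_single_mem k l)
  rintro l' ⟨h1, h2⟩
  exact ⟨by have := hl.1; omega, hl.2.1.sublist h1, fun x hx => hl.2.2 x (h1.subset hx)⟩

variable {k} in
-- Since `u` is least in `S`, a sorted list either starts with `u` or does not contain it. If it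
-- does not contain `u`, the identity is the cone formula. If it starts with `u`, the cone of the
-- list vanishes, and in its boundary only the face without `u` survives the cone, which restores
-- the list.
theorem listCone_homotopy {S : Set X} {u : X} (hu : IsLeast S u) {n : ℕ} {h : List X →₀ k}
    (hh : h ∈ Finsupp.supported k k (sortedLists S n)) :
    listBoundary k (listCone k u h) + listCone k u (listBoundary k h) = h := by
  rw [Finsupp.supported_eq_span_single] at hh
  refine LinearMap.eqOn_span (f := listBoundary k ∘ₗ listCone k u + listCone k u ∘ₗ listBoundary k)
    (g := LinearMap.id) ?_ hh
  rintro _ ⟨l, hl, rfl⟩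
  change listBoundary k (listCone k u (Finsupp.single l 1)) +
    listCone k u (listBoundary k (Finsupp.single l 1)) = Finsupp.single l 1
  by_cases hd : l.head? = some u
  · obtain ⟨t, rfl⟩ : ∃ t, l = u :: t := by
      cases l with
      | nil => simp at hd
      | cons x t => exact ⟨t, by simpa using hd⟩
    have ht : u ∉ t := fun h => lt_irrefl u ((List.pairwise_cons.1 hl.2.1).1 u h)
    rw [listCone_single_of_head k hd, listBoundary_single_cons, map_sub, listCone_cons,
      listCone_single k fun h => ht (List.mem_of_mem_head? h)]
    simp
  · have hl' : u ∉ l := by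
      intro h
      cases l with
      | nil => simp at h
      | cons x t =>
        rcases List.mem_cons.1 h with rfl | h
        · simp at hd
        · exact ((List.pairwise_cons.1 hl.2.1).1 u h).not_ge
            (hu.2 (hl.2.2 x List.mem_cons_self))
    rw [listCone_single k hd, listBoundary_single_cons, listCone_of_mem_supported]
    · simp
    · exact Finsupp.supported_mono (fun l' h1 (h2 : u ∈ l') => hl' (h1.1.subset h2))
        (listBoundary_single_mem k l)

theorem listCone_mem_supported {S : Set X} {u : X} (hu : IsLeast S u) {n : ℕ} {h : List X →₀ k}
    (hh : h ∈ Finsupp.supported k k (sortedLists S n)) :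
    listCone k u h ∈ Finsupp.supported k k (sortedLists S (n + 1)) := by
  rw [Finsupp.supported_eq_span_single] at hh
  refine (Submodule.span_le (p := (Finsupp.supported k k _).comap (listCone k u))).2 ?_ hh
  rintro _ ⟨l, hl, rfl⟩
  rw [SetLike.mem_coe, Submodule.mem_comap]
  by_cases hd : l.head? = some u
  · rw [listCone_single_of_head k hd]; exact zero_mem _
  · rw [listCone_single k hd]
    refine Finsupp.single_mem_supported k 1 ⟨by simp [hl.1], ?_, ?_⟩
    · refine List.pairwise_cons.2 ⟨fun x hx => lt_of_le_of_ne (hu.2 (hl.2.2 x hx)) ?_, hl.2.1⟩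
      rintro rfl
      cases l with
      | nil => simp at hx
      | cons y t =>
        rcases List.mem_cons.1 hx with rfl | h
        · simp at hd
        · exact ((List.pairwise_cons.1 hl.2.1).1 _ h).not_ge
            (hu.2 (hl.2.2 y List.mem_cons_self))
    · intro x hx
      rcases List.mem_cons.1 hx with rfl | h
      exacts [hu.1, hl.2.2 x h]

variable {k} in
/-- The augmented complex of sorted lists in a set with a least element is exact. -/
theorem exists_listBoundary_eq {S : Set X} {u : X} (hu : IsLeast S u) {n : ℕ} {h : List X →₀ k}
    (hh : h ∈ Finsupp.supported k k (sortedLists S n)) (h0 : listBoundary k h = 0) :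
    ∃ g ∈ Finsupp.supported k k (sortedLists S (n + 1)), listBoundary k g = h :=
  ⟨listCone k u h, listCone_mem_supported k hu hh, by
    simpa [h0] using listCone_homotopy hu hh⟩

end ListComplex

/-! ### Algebras with the multiplicative basis of an incidence algebra -/

/-- A presentation of an algebra as the incidence algebra of a finite poset: a representation by
matrices and elements mapped to the matrix units of the relations, which span the algebra. -/
structure IncidenceData (k : Type*) [Field k] (R : Type*) [Ring R] [Algebra k R] (Z : Type*)
    [PartialOrder Z] [Fintype Z] [DecidableEq Z] where
  /-- The basis elements; only the values at `z ≤ w` matter. -/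
  E : Z → Z → R
  /-- The representation by matrices. -/
  ρ : R →ₐ[k] Matrix Z Z k
  ρ_E : ∀ z w, z ≤ w → ρ (E z w) = Matrix.single z w 1
  mem_span : ∀ r : R, r ∈ Submodule.span k {r | ∃ z w, z ≤ w ∧ E z w = r}

namespace IncidenceData

section

variable {k : Type*} [Field k] {R : Type*} [Ring R] [Algebra k R] {Z : Type*}
  [PartialOrder Z] [Fintype Z] [DecidableEq Z] (D : IncidenceData k R Z)

theorem ρ_apply_of_not_le (r : R) {z w : Z} (h : ¬ z ≤ w) : D.ρ r z w = 0 := by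
  induction D.mem_span r using Submodule.span_induction with
  | mem r hr =>
    obtain ⟨x, y, hxy, rfl⟩ := hr
    rw [D.ρ_E x y hxy, Matrix.single_apply_of_ne]
    rintro ⟨rfl, rfl⟩
    exact h hxy
  | zero => simp
  | add r s _ _ hr hs => simp [hr, hs]
  | smul c r _ hr => simp [hr]

/-- Both sides are linear in `r` and agree on the spanning elements. Off the order relation the
matrix entry vanishes, so the arbitrary values of `E` there do no harm. Consequently `ρ` is faithful
and identities in `R` can be checked on matrices. -/
theorem eq_sum (r : R) : r = ∑ z, ∑ w, D.ρ r z w • D.E z w := by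
  induction D.mem_span r using Submodule.span_induction with
  | mem r hr =>
    obtain ⟨x, y, hxy, rfl⟩ := hr
    rw [D.ρ_E x y hxy, Finset.sum_eq_single x, Finset.sum_eq_single y]
    · simp
    · intro w _ hw
      rw [Matrix.single_apply_of_ne, zero_smul]
      exact fun h => hw h.2.symm
    · simp
    · intro z _ hz
      refine Finset.sum_eq_zero fun w _ => ?_
      rw [Matrix.single_apply_of_ne, zero_smul]
      exact fun h => hz h.1.symm
    · simp
  | zero => simp
  | add r s _ _ hr hs =>
    simp only [map_add, Matrix.add_apply, add_smul, Finset.sum_add_distrib]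
    rw [← hr, ← hs]
  | smul c r _ hr =>
    simp only [map_smul, Matrix.smul_apply, smul_assoc, ← Finset.smul_sum]
    rw [← hr]

theorem ρ_injective : Function.Injective D.ρ := fun r s h => by
  rw [D.eq_sum r, D.eq_sum s, h]

theorem mul_E (r : R) {z w : Z} (h : z ≤ w) : r * D.E z w = ∑ v, D.ρ r v z • D.E v w := by
  refine D.ρ_injective ?_
  -- If `v ≤ z` fails, the coefficient is zero, so nothing need be known about `E v w`.
  have : ∀ v, D.ρ (D.ρ r v z • D.E v w) = D.ρ r v z • Matrix.single v w (1 : k) := by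
    intro v
    by_cases hv : v ≤ z
    · rw [map_smul, D.ρ_E v w (hv.trans h)]
    · rw [D.ρ_apply_of_not_le r hv, zero_smul, zero_smul, map_zero]
  rw [map_mul, D.ρ_E z w h, map_sum]
  simp only [this]
  ext x y
  rw [Matrix.sum_apply]
  by_cases hy : y = w
  · subst hy
    simp [Matrix.single_apply]
  · rw [Matrix.mul_single_apply_of_ne _ _ _ _ _ hy]
    refine (Finset.sum_eq_zero fun v _ => ?_).symm
    simp [Ne.symm hy]

/-- The space of all functions on the poset with values in `H`, as a module over the incidence
algebra acting by matrices. -/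
def RepSpace (_ : IncidenceData k R Z) (H : Type*) : Type _ := Z → H

variable {H : Type*} [AddCommGroup H] [Module k H] {H' : Type*} [AddCommGroup H'] [Module k H']

instance : AddCommGroup (D.RepSpace H) := inferInstanceAs (AddCommGroup (Z → H))

instance : Module k (D.RepSpace H) := inferInstanceAs (Module k (Z → H))

open scoped Matrix.Module in
noncomputable instance : Module R (D.RepSpace H) :=
  letI : Module (Matrix Z Z k) (D.RepSpace H) := inferInstanceAs (Module (Matrix Z Z k) (Z → H))
  Module.compHom _ D.ρ.toRingHom

theorem RepSpace.smul_apply (r : R) (f : D.RepSpace H) (z : Z) :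
    (r • f) z = ∑ w, D.ρ r z w • f w := rfl

instance : IsScalarTower k R (D.RepSpace H) := ⟨fun c r f => by
  funext z
  change _ = c • (r • f) z
  simp only [RepSpace.smul_apply, map_smul, Matrix.smul_apply, smul_assoc, Finset.smul_sum]⟩

/-- The representation given by a decreasing family of subspaces of a vector space. -/
noncomputable def Rep {G : Z → Submodule k H} (hG : Antitone G) : Submodule R (D.RepSpace H) where
  carrier := {f | ∀ z, f z ∈ G z}
  add_mem' hf hg z := add_mem (hf z) (hg z)
  zero_mem' _ := zero_mem _
  smul_mem' r f hf z := by
    rw [RepSpace.smul_apply]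
    refine sum_mem fun w _ => ?_
    by_cases h : z ≤ w
    · exact (G z).smul_mem _ (hG h (hf w))
    · rw [D.ρ_apply_of_not_le r h, zero_smul]
      exact zero_mem _

variable {G : Z → Submodule k H} (hG : Antitone G) {G' : Z → Submodule k H'} (hG' : Antitone G')

namespace Rep

variable {D} in
@[ext]
theorem ext {hG : Antitone G} {f g : D.Rep hG} (h : ∀ z, f.1 z = g.1 z) : f = g :=
  Subtype.ext (funext h)

/-- The map of representations induced by a linear map. -/
noncomputable def map (φ : H →ₗ[k] H') (hφ : ∀ z, ∀ h ∈ G z, φ h ∈ G' z) :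
    D.Rep hG →ₗ[R] D.Rep hG' where
  toFun f := ⟨fun z => φ (f.1 z), fun z => hφ z _ (f.2 z)⟩
  map_add' f g := ext fun z => map_add φ _ _
  map_smul' r f := ext fun z => by
    change φ (∑ w, D.ρ r z w • f.1 w) = ∑ w, D.ρ r z w • φ (f.1 w)
    simp only [map_sum, map_smul]

theorem map_apply (φ : H →ₗ[k] H') (hφ : ∀ z, ∀ h ∈ G z, φ h ∈ G' z) (f : D.Rep hG) (z : Z) :
    (map D hG hG' φ hφ f).1 z = φ (f.1 z) := rfl

/-- The function concentrated at one vertex. -/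
def delta (z : Z) (h : H) (hh : h ∈ G z) : D.Rep hG :=
  ⟨fun w => if w = z then h else 0, fun w => by
    dsimp only
    split_ifs with hw
    · rw [hw]; exact hh
    · exact zero_mem _⟩

theorem delta_apply (z : Z) (h : H) (hh : h ∈ G z) (w : Z) :
    (delta D hG z h hh).1 w = if w = z then h else 0 := rfl

theorem sum_delta (f : D.Rep hG) : ∑ z, delta D hG z (f.1 z) (f.2 z) = f := by
  refine ext fun w => ?_
  have : (∑ z, delta D hG z (f.1 z) (f.2 z)).1 w =
      ∑ z, (delta D hG z (f.1 z) (f.2 z)).1 w := by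
    rw [Submodule.coe_sum]
    exact Finset.sum_apply w _ _
  rw [this]
  simp only [delta_apply]
  exact (Finset.sum_ite_eq Finset.univ w f.1).trans (if_pos (Finset.mem_univ w))

theorem E_smul_apply {z w : Z} (hzw : z ≤ w) (f : D.Rep hG) (x : Z) :
    (D.E z w • f).1 x = if x = z then f.1 w else 0 := by
  change (D.E z w • f.1) x = _
  rw [RepSpace.smul_apply, D.ρ_E z w hzw]
  by_cases hx : x = z
  · subst hx
    simp only [Matrix.single_apply, true_and, if_true, ite_smul, one_smul, zero_smul]
    exact (Finset.sum_ite_eq Finset.univ w f.1).trans (if_pos (Finset.mem_univ w))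
  · simp [hx, Ne.symm hx]

/-- Matrix units carry a vector from the vertex `w` down to `z`. Hence a basis element that occurs
exactly below `t l` generates all its copies from the one at `t l`. -/
theorem E_smul_delta {z w : Z} (hzw : z ≤ w) (h : H) (hh : h ∈ G w) :
    D.E z w • delta D hG w h hh = delta D hG z h (hG hzw hh) := by
  refine ext fun x => ?_
  rw [E_smul_apply D hG hzw, delta_apply, delta_apply, if_pos rfl]

end Rep

end

/-! ### Projectivity of representations spanned by basis elements -/

section Supported

variable {k : Type*} [Field k] {R : Type*} [Ring R] [Algebra k R] {Z : Type*}
  [PartialOrder Z] [Fintype Z] [DecidableEq Z] (D : IncidenceData k R Z) {B : Type*}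

/-- The linear map sending a basis element `l` to the matrix unit from `z` to the vertex of `l`. -/
noncomputable def generatorMap (t : B → Z) (z : Z) : (B →₀ k) →ₗ[k] (B →₀ R) :=
  Finsupp.linearCombination k fun l => Finsupp.single l (D.E z (t l))

theorem generatorMap_single (t : B → Z) (z : Z) (l : B) :
    D.generatorMap t z (Finsupp.single l 1) = Finsupp.single l (D.E z (t l)) := by
  simp [generatorMap]

/-- On `E w (t l)` the element `r` acts through column `w` of its matrix, which needs `w ≤ t l`.
This is the linearity of the embedding into a free module below. -/
theorem smul_generatorMap (t : B → Z) (r : R) (w : Z) {h : B →₀ k}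
    (hh : h ∈ Finsupp.supported k k {l | w ≤ t l}) :
    r • D.generatorMap t w h = ∑ z, D.ρ r z w • D.generatorMap t z h := by
  rw [Finsupp.supported_eq_span_single] at hh
  have := LinearMap.eqOn_span (R := k)
    (f := Algebra.lsmul k k (B →₀ R) r ∘ₗ D.generatorMap t w)
    (g := ∑ z, D.ρ r z w • D.generatorMap t z) ?_ hh
  · simpa using this
  · rintro _ ⟨l, hl, rfl⟩
    simp only [LinearMap.comp_apply, Algebra.lsmul_coe, LinearMap.sum_apply, LinearMap.smul_apply,
      generatorMap_single, Finsupp.smul_single, smul_eq_mul]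
    rw [D.mul_E r hl]
    exact map_sum (Finsupp.singleAddHom l) _ _

/-- The representation of the subspaces spanned by subsets of a basis is projective, if the
vertices at which a given basis element appears form a principal ideal. -/
theorem projective_rep_supported {C : Z → Set B}
    (hC : Antitone fun z => Finsupp.supported k k (C z)) (t : B → Z)
    (ht : ∀ l z, l ∈ C z → ∀ w, l ∈ C w ↔ w ≤ t l) :
    Module.Projective R (D.Rep hC) := by
  classical
  -- Embedding into a free module: the basis element `l` at the vertex `z` goes to `E z (t l)` in
  -- the copy of `R` indexed by `l`, that is, into the column of `t l`.
  let i : D.Rep hC →ₗ[R] (B →₀ R) :=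
    { toFun f := ∑ z, D.generatorMap t z (f.1 z)
      map_add' f g := by
        rw [← Finset.sum_add_distrib]
        exact Finset.sum_congr rfl fun z _ => map_add _ _ _
      map_smul' r f := by
        have h (w : Z) : f.1 w ∈ Finsupp.supported k k {l | w ≤ t l} :=
          Finsupp.supported_mono (fun l hl => (ht l w hl w).1 hl) (f.2 w)
        rw [RingHom.id_apply, Finset.smul_sum,
          Finset.sum_congr rfl fun w _ => D.smul_generatorMap t r w (h w), Finset.sum_comm]
        refine Finset.sum_congr rfl fun z _ => ?_
        change D.generatorMap t z ((r • f.1) z) = _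
        simp only [RepSpace.smul_apply, map_sum, map_smul] }
  have hgen (l : B) (hl : ∃ z, l ∈ C z) :
      Finsupp.single l 1 ∈ Finsupp.supported k k (C (t l)) := by
    obtain ⟨z, hz⟩ := hl
    exact Finsupp.single_mem_supported k 1 ((ht l z hz _).2 le_rfl)
  -- The retraction sends the generator of the `l`-th copy to `l` placed at `t l`. Basis elements
  -- that occur at no vertex are sent to zero.
  let g (l : B) : D.Rep hC :=
    if hl : ∃ z, l ∈ C z then Rep.delta D hC (t l) (Finsupp.single l 1) (hgen l hl) else 0
  let s : (B →₀ R) →ₗ[R] D.Rep hC := Finsupp.linearCombination R g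
  have key (z : Z) (h : B →₀ k) (hh : h ∈ Finsupp.supported k k (C z)) :
      s (D.generatorMap t z h) = Rep.delta D hC z h hh := by
    have hh' := hh
    rw [Finsupp.supported_eq_span_single] at hh'
    induction hh' using Submodule.span_induction with
    | mem h h1 =>
      obtain ⟨l, hl, rfl⟩ := h1
      rw [generatorMap_single, Finsupp.linearCombination_single]
      simp only [g]
      rw [dif_pos ⟨z, hl⟩, Rep.E_smul_delta D hC ((ht l z hl z).1 hl)]
    | zero =>
      rw [map_zero, map_zero]
      exact Rep.ext fun w => (ite_self (c := w = z) (0 : B →₀ k)).symm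
    | add h h' h1 h2 ih ih' =>
      rw [← Finsupp.supported_eq_span_single] at h1 h2
      rw [map_add, map_add, ih h1, ih' h2]
      refine Rep.ext fun w => ?_
      change (Rep.delta D hC z h h1).1 w + (Rep.delta D hC z h' h2).1 w = _
      simp only [Rep.delta_apply]
      split_ifs <;> simp
    | smul c h h1 ih =>
      rw [← Finsupp.supported_eq_span_single] at h1
      rw [map_smul, LinearMap.map_smul_of_tower, ih h1]
      refine Rep.ext fun w => ?_
      change c • (Rep.delta D hC z h h1).1 w = _
      simp only [Rep.delta_apply]
      split_ifs <;> simp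
  refine Module.Projective.of_split i s (LinearMap.ext fun f => ?_)
  change s (∑ z, D.generatorMap t z (f.1 z)) = f
  rw [map_sum, Finset.sum_congr rfl fun z _ => key z _ (f.2 z), Rep.sum_delta]

end Supported

end IncidenceData

namespace IncidenceData

/-! ### Maps are determined by the generators -/

section HomExt

variable {k : Type*} [Field k] {R : Type*} [Ring R] [Algebra k R] {Z : Type*}
  [PartialOrder Z] [Fintype Z] [DecidableEq Z] (D : IncidenceData k R Z) {B : Type*}
  {C : Z → Set B} (hC : Antitone fun z => Finsupp.supported k k (C z)) (t : B → Z)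
  (ht : ∀ l z, l ∈ C z → ∀ w, l ∈ C w ↔ w ≤ t l)
  {M : Type*} [AddCommGroup M] [Module R M] [Module k M] [IsScalarTower k R M]

theorem Rep.delta_add {H : Type*} [AddCommGroup H] [Module k H] {G : Z → Submodule k H}
    (hG : Antitone G) (z : Z) {h h' : H} (hh : h ∈ G z) (hh' : h' ∈ G z) :
    Rep.delta D hG z (h + h') (add_mem hh hh') = Rep.delta D hG z h hh + Rep.delta D hG z h' hh' := by
  refine Rep.ext fun w => ?_
  change _ = (Rep.delta D hG z h hh).1 w + (Rep.delta D hG z h' hh').1 w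
  simp only [Rep.delta_apply]
  split_ifs <;> simp

theorem Rep.delta_smul {H : Type*} [AddCommGroup H] [Module k H] {G : Z → Submodule k H}
    (hG : Antitone G) (z : Z) (c : k) {h : H} (hh : h ∈ G z) :
    Rep.delta D hG z (c • h) ((G z).smul_mem c hh) = c • Rep.delta D hG z h hh := by
  refine Rep.ext fun w => ?_
  change _ = c • (Rep.delta D hG z h hh).1 w
  simp only [Rep.delta_apply]
  split_ifs <;> simp

theorem Rep.delta_zero {H : Type*} [AddCommGroup H] [Module k H] {G : Z → Submodule k H}
    (hG : Antitone G) (z : Z) : Rep.delta D hG z 0 (zero_mem _) = 0 :=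
  Rep.ext fun w => ite_self (c := w = z) (0 : H)

include ht in
/-- Linear maps out of a representation spanned by subsets of a basis agree if they agree on the
generators. -/
theorem rep_supported_hom_ext {f g : D.Rep hC →ₗ[R] M}
    (hfg : ∀ l (hl : Finsupp.single l 1 ∈ Finsupp.supported k k (C (t l))),
      f (Rep.delta D hC (t l) (Finsupp.single l 1) hl) =
        g (Rep.delta D hC (t l) (Finsupp.single l 1) hl)) : f = g := by
  have key (z : Z) (h : B →₀ k) (hh : h ∈ Finsupp.supported k k (C z)) :
      f (Rep.delta D hC z h hh) = g (Rep.delta D hC z h hh) := by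
    have hh' := hh
    rw [Finsupp.supported_eq_span_single] at hh'
    induction hh' using Submodule.span_induction with
    | mem h' h1 =>
      obtain ⟨l, hl, rfl⟩ := h1
      have hz : z ≤ t l := (ht l z hl z).1 hl
      have hl' : Finsupp.single l 1 ∈ Finsupp.supported k k (C (t l)) :=
        Finsupp.single_mem_supported k 1 ((ht l z hl _).2 le_rfl)
      rw [← Rep.E_smul_delta D hC hz _ hl', map_smul, map_smul, hfg l hl']
    | zero => rw [Rep.delta_zero, map_zero, map_zero]
    | add h h' h1 h2 ih ih' =>
      rw [← Finsupp.supported_eq_span_single] at h1 h2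
      rw [Rep.delta_add D hC z h1 h2, map_add, map_add, ih h1, ih' h2]
    | smul c h h1 ih =>
      rw [← Finsupp.supported_eq_span_single] at h1
      rw [Rep.delta_smul D hC z c h1, LinearMap.map_smul_of_tower, LinearMap.map_smul_of_tower,
        ih h1]
  refine LinearMap.ext fun F => ?_
  rw [← Rep.sum_delta D hC F, map_sum, map_sum]
  exact Finset.sum_congr rfl fun z _ => key z _ _

end HomExt

/-! ### Maps into the representation of a lower set, as cochains -/

section Cochains

variable {k : Type u} [Field k] {R : Type u} [Ring R] [Algebra k R] {Z : Type u}
  [PartialOrder Z] [Fintype Z] [DecidableEq Z] (D : IncidenceData k R Z) {B : Type u}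

open Classical in
/-- The family of subspaces of `k` which is `k` on a lower set and `0` elsewhere. -/
noncomputable def indicator (k : Type*) [Field k] {Z : Type*} [PartialOrder Z] (W : LowerSet Z)
    (z : Z) : Submodule k k :=
  if z ∈ W then ⊤ else ⊥

theorem indicator_of_mem {k : Type*} [Field k] {Z : Type*} [PartialOrder Z] {W : LowerSet Z} {z : Z} (h : z ∈ W) : indicator k W z = ⊤ := if_pos h

theorem indicator_of_notMem {k : Type*} [Field k] {Z : Type*} [PartialOrder Z] {W : LowerSet Z} {z : Z} (h : z ∉ W) : indicator k W z = ⊥ := if_neg h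

theorem antitone_indicator {k : Type*} [Field k] {Z : Type*} [PartialOrder Z] (W : LowerSet Z) : Antitone (indicator k W) := by
  intro z w h
  by_cases hw : w ∈ W
  · rw [indicator_of_mem (W.lower h hw)]; exact le_top
  · rw [indicator_of_notMem hw]; exact bot_le

/-- The functional on `B →₀ k` which extends a function along `ℓ : J → B` by zero. -/
noncomputable def cochainFunctional {J : Type*} (ℓ : J → B) :
    (J → k) →ₗ[k] (B →₀ k) →ₗ[k] k where
  toFun θ := Finsupp.linearCombination k (Function.extend ℓ θ 0)
  map_add' θ θ' := by
    refine Finsupp.lhom_ext' fun l => LinearMap.ext_ring ?_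
    classical
    by_cases h : ∃ j, ℓ j = l <;> simp [Function.extend, h]
  map_smul' c θ := by
    refine Finsupp.lhom_ext' fun l => LinearMap.ext_ring ?_
    classical
    by_cases h : ∃ j, ℓ j = l <;> simp [Function.extend, h]

theorem cochainFunctional_single {J : Type*} {ℓ : J → B} (hℓ : Function.Injective ℓ) (θ : J → k)
    (j : J) : cochainFunctional ℓ θ (Finsupp.single (ℓ j) 1) = θ j := by
  simp [cochainFunctional, hℓ.extend_apply]

theorem cochainFunctional_single_of_notMem {J : Type*} {ℓ : J → B} (θ : J → k)
    {l : B} (hl : l ∉ Set.range ℓ) : cochainFunctional ℓ θ (Finsupp.single l 1) = 0 := by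
  simp only [cochainFunctional, LinearMap.coe_mk, AddHom.coe_mk, Finsupp.linearCombination_single,
    one_smul]
  exact Function.extend_apply' _ _ _ hl

variable {C : Z → Set B} (hC : Antitone fun z => Finsupp.supported k k (C z)) {W : LowerSet Z}

omit [Fintype Z] [DecidableEq Z] in
theorem cochainFunctional_mem_indicator {J : Type*} {ℓ : J → B}
    (hW : ∀ j z, ℓ j ∈ C z → z ∈ W) (θ : J → k) (z : Z) (h : B →₀ k)
    (hh : h ∈ Finsupp.supported k k (C z)) : cochainFunctional ℓ θ h ∈ indicator k W z := by
  by_cases hz : z ∈ W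
  · rw [indicator_of_mem hz]; trivial
  · rw [indicator_of_notMem hz, Submodule.mem_bot]
    rw [Finsupp.supported_eq_span_single] at hh
    refine LinearMap.eqOn_span (g := 0) ?_ hh
    rintro _ ⟨l, hl, rfl⟩
    refine cochainFunctional_single_of_notMem θ ?_
    rintro ⟨j, rfl⟩
    exact hz (hW j z hl)

variable {N : ModuleCat.{u} R} (e : D.Rep (antitone_indicator (k := k) W) ≃ₗ[R] N)

/-- Morphisms into the representation of a lower set given by cochains. -/
noncomputable def cochainHom {J : Type*} {ℓ : J → B} (hW : ∀ j z, ℓ j ∈ C z → z ∈ W) :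
    (J → k) →ₗ[k] (ModuleCat.of R (D.Rep hC) ⟶ N) where
  toFun θ := ModuleCat.ofHom (e.toLinearMap ∘ₗ Rep.map D hC (antitone_indicator W)
    (cochainFunctional ℓ θ) (cochainFunctional_mem_indicator hW θ))
  map_add' θ θ' := by
    ext f
    change e _ = e _ + e _
    rw [← map_add]
    congr 1
    refine Rep.ext fun z => ?_
    simp only [Rep.map_apply, map_add]
    rfl
  map_smul' c θ := by
    ext f
    change e _ = algebraMap k R c • e _
    rw [← map_smul, algebraMap_smul]
    congr 1
    refine Rep.ext fun z => ?_
    simp only [Rep.map_apply, map_smul]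
    rfl

theorem cochainHom_apply {J : Type*} {ℓ : J → B} (hW : ∀ j z, ℓ j ∈ C z → z ∈ W) (θ : J → k)
    (f : D.Rep hC) (z : Z) :
    (e.symm ((cochainHom D hC e hW θ).hom f)).1 z = cochainFunctional ℓ θ (f.1 z) := by
  change (e.symm (e _)).1 z = _
  rw [e.symm_apply_apply]
  rfl

/-- A map is determined by the images of the generators, `l` placed at `t l`. Such an image is
concentrated at `t l`, so it is an arbitrary scalar if `t l ∈ W` and zero otherwise. The hypotheses
make `J` an indexing of exactly the `l` with `t l ∈ W`. -/
theorem cochainHom_bijective {J : Type*} {ℓ : J → B} (hW : ∀ j z, ℓ j ∈ C z → z ∈ W) (t : B → Z)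
    (ht : ∀ l z, l ∈ C z → ∀ w, l ∈ C w ↔ w ≤ t l) (hℓ : Function.Injective ℓ)
    (hℓC : ∀ j, ∃ z, ℓ j ∈ C z) (hrange : ∀ l z, l ∈ C z → t l ∈ W → l ∈ Set.range ℓ) :
    Function.Bijective (cochainHom D hC e hW) := by
  have hgen (j : J) : Finsupp.single (ℓ j) 1 ∈ Finsupp.supported k k (C (t (ℓ j))) := by
    obtain ⟨z, hz⟩ := hℓC j
    exact Finsupp.single_mem_supported k 1 ((ht _ z hz _).2 le_rfl)
  constructor
  · refine (injective_iff_map_eq_zero _).2 fun θ hθ => funext fun j => ?_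
    have := cochainHom_apply D hC e hW θ
      (Rep.delta D hC (t (ℓ j)) (Finsupp.single (ℓ j) 1) (hgen j)) (t (ℓ j))
    rw [Rep.delta_apply, if_pos rfl, cochainFunctional_single hℓ, hθ] at this
    rw [← this]
    change (e.symm 0).1 _ = _
    rw [map_zero]
    rfl
  · intro f
    let f' : D.Rep hC →ₗ[R] D.Rep (antitone_indicator (k := k) W) := e.symm.toLinearMap ∘ₗ f.hom
    let θ : J → k := fun j =>
      (f' (Rep.delta D hC (t (ℓ j)) (Finsupp.single (ℓ j) 1) (hgen j))).1 (t (ℓ j))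
    have hf' : Rep.map D hC (antitone_indicator W)
        (cochainFunctional ℓ θ) (cochainFunctional_mem_indicator hW θ) = f' := by
      refine rep_supported_hom_ext D hC t ht fun l hl => Rep.ext fun z => ?_
      -- The idempotent `E (t l) (t l)` fixes the generator, so both images are concentrated at `t
      -- l` and only that value must be compared.
      have h1 := Rep.E_smul_delta D hC (le_refl (t l)) _ hl
      rw [← h1, map_smul, map_smul, Rep.E_smul_apply _ _ le_rfl, Rep.E_smul_apply _ _ le_rfl]
      congr 1
      rw [Rep.map_apply, Rep.delta_apply, if_pos rfl]
      have hl' : l ∈ C (t l) := by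
        rw [Finsupp.mem_supported] at hl
        exact hl (by simp)
      by_cases hlW : t l ∈ W
      · obtain ⟨j, rfl⟩ := hrange l _ hl' hlW
        rw [cochainFunctional_single hℓ]
      · rw [cochainFunctional_single_of_notMem]
        · have := (f' (Rep.delta D hC (t l) (Finsupp.single l 1) hl)).2 (t l)
          rw [indicator_of_notMem hlW, Submodule.mem_bot] at this
          exact this.symm
        · rintro ⟨j, rfl⟩
          exact hlW (hW j _ hl')
    refine ⟨θ, ?_⟩
    ext F
    change e (Rep.map D hC (antitone_indicator W)
        (cochainFunctional ℓ θ) (cochainFunctional_mem_indicator hW θ) F) = f.hom F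
    rw [hf']
    exact e.apply_symm_apply _

end Cochains

end IncidenceData

/-! ### The resolution by sorted lists -/

/-- A decreasing family of sets of possible list entries, indexed by a poset, together with a lower
set of vertices at which lists are admitted. -/
structure ListFamily (Z X : Type*) [PartialOrder Z] [PartialOrder X] where
  /-- The set of possible entries. -/
  S : Z → Set X
  /-- The vertices at which lists are admitted. -/
  U : LowerSet Z
  antitone_S : Antitone S
  exists_isLeast : ∀ z ∈ U, S z = ∅ ∨ ∃ u, IsLeast (S z) u

namespace ListFamily

section

variable {Z X : Type*} [PartialOrder Z] [PartialOrder X] (F : ListFamily Z X)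

/-- The sorted lists of length `n` admitted at a vertex. -/
def lists (n : ℕ) (z : Z) : Set (List X) := {l | l ∈ sortedLists (F.S z) n ∧ z ∈ F.U}

theorem antitone_supported (k : Type*) [Field k] (n : ℕ) :
    Antitone fun z => Finsupp.supported k k (F.lists n z) := fun _ _ h =>
  Finsupp.supported_mono fun _ hl => ⟨sortedLists_mono (F.antitone_S h) n hl.1, F.U.lower h hl.2⟩

theorem mem_supported_iff {k : Type*} [Field k] {n : ℕ} {z : Z} (hz : z ∈ F.U) (h : List X →₀ k) :
    h ∈ Finsupp.supported k k (F.lists n z) ↔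
      h ∈ Finsupp.supported k k (sortedLists (F.S z) n) := by
  have : F.lists n z = sortedLists (F.S z) n := Set.ext fun l => and_iff_left hz
  rw [this]

theorem eq_zero_of_notMem {k : Type*} [Field k] {n : ℕ} {z : Z} (hz : z ∉ F.U) {h : List X →₀ k}
    (hh : h ∈ Finsupp.supported k k (F.lists n z)) : h = 0 := by
  have : F.lists n z = ∅ := Set.eq_empty_of_forall_notMem fun l hl => hz hl.2
  rw [this, Finsupp.supported_empty] at hh
  exact (Submodule.mem_bot k).1 hh

theorem listBoundary_mem {k : Type*} [Field k] {n : ℕ} (z : Z) (h : List X →₀ k)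
    (hh : h ∈ Finsupp.supported k k (F.lists (n + 1) z)) :
    listBoundary k h ∈ Finsupp.supported k k (F.lists n z) := by
  by_cases hz : z ∈ F.U
  · rw [F.mem_supported_iff hz] at hh ⊢
    exact listBoundary_mem_supported k hh
  · rw [F.eq_zero_of_notMem hz hh, map_zero]
    exact zero_mem _

/-- Where `S z` is empty there are no nonempty lists, and elsewhere in `U` the cone on the least
element applies. Positive length is essential: over an empty `S z` the empty list is a cycle that is
not a boundary. -/
theorem exists_boundary_eq {k : Type*} [Field k] {n : ℕ} (z : Z) {h : List X →₀ k}
    (hh : h ∈ Finsupp.supported k k (F.lists (n + 1) z)) (h0 : listBoundary k h = 0) :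
    ∃ g ∈ Finsupp.supported k k (F.lists (n + 2) z), listBoundary k g = h := by
  by_cases hz : z ∈ F.U
  · rw [F.mem_supported_iff hz] at hh
    simp only [F.mem_supported_iff hz]
    obtain hS | ⟨u, hu⟩ := F.exists_isLeast z hz
    · have : sortedLists (F.S z) (n + 1) = ∅ := by
        refine Set.eq_empty_of_forall_notMem fun l hl => ?_
        cases l with
        | nil => simpa using hl.1
        | cons x l => exact (hS ▸ hl.2.2 x List.mem_cons_self : x ∈ (∅ : Set X))
      rw [this, Finsupp.supported_empty, Submodule.mem_bot] at hh
      exact ⟨0, zero_mem _, by rw [hh, map_zero]⟩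
    · exact exists_listBoundary_eq hu hh h0
  · rw [F.eq_zero_of_notMem hz hh]
    exact ⟨0, zero_mem _, map_zero _⟩

end

variable {k : Type u} [Field k] {R : Type u} [Ring R] [Algebra k R] {Z : Type u}
  [PartialOrder Z] [Fintype Z] [DecidableEq Z] (D : IncidenceData k R Z) {X : Type u}
  [PartialOrder X] (F : ListFamily Z X)

/-- The representation spanned by the admitted lists of length `n`. -/
noncomputable abbrev rep (n : ℕ) : Submodule R (D.RepSpace (List X →₀ k)) :=
  D.Rep (F.antitone_supported k n)

/-- The boundary map of representations. -/
noncomputable def d (n : ℕ) : F.rep D (n + 1) →ₗ[R] F.rep D n :=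
  IncidenceData.Rep.map D _ _ (listBoundary k) F.listBoundary_mem

/-- Exactness is checked vertex by vertex. The chosen preimages need no compatibility, as an element
of `Rep` is any function with values in the given subspaces. -/
theorem exact_d (n : ℕ) : Function.Exact (F.d D (n + 1)) (F.d D n) := by
  intro f
  constructor
  · intro hf
    have h (z : Z) := F.exists_boundary_eq z (f.2 z) (congrArg (fun g => g.1 z) hf)
    choose g hg hgf using h
    exact ⟨⟨g, hg⟩, IncidenceData.Rep.ext hgf⟩
  · rintro ⟨g, rfl⟩
    exact IncidenceData.Rep.ext fun z => listBoundary_listBoundary k _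

/-- `Ext` of a module resolved by representations spanned by lists with coefficients in the
representation of a lower set, in terms of cochains on the lists at vertices of the lower set. -/
theorem nonempty_ext_linearEquiv (m : ℕ) (t : List X → Z)
    (ht : ∀ n, m ≤ n → ∀ l z, l ∈ F.lists n z → ∀ w, l ∈ F.lists n w ↔ w ≤ t l)
    {M N : ModuleCat.{u} R} (π : F.rep D m →ₗ[R] M) (hπ : Function.Surjective π)
    (hπd : Function.Exact (F.d D m) π) {W : LowerSet Z}
    (e : D.Rep (IncidenceData.antitone_indicator (k := k) W) ≃ₗ[R] N) (n : ℕ)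
    {J : ℕ → Type u} (ℓ : ∀ i, J i → List X)
    (hℓ : ∀ i, Function.Injective (ℓ i))
    (hℓF : ∀ i j, ∃ z, ℓ i j ∈ F.lists (m + (n + i)) z)
    (hW : ∀ i j z, ℓ i j ∈ F.lists (m + (n + i)) z → z ∈ W)
    (hrange : ∀ i l z, l ∈ F.lists (m + (n + i)) z → t l ∈ W → l ∈ Set.range (ℓ i))
    (δ : ∀ i, (J i → k) →ₗ[k] (J (i + 1) → k)) (ε : k) (hε : ε * ε = 1)
    (hδ : ∀ i θ, ∀ z ∈ W, ∀ l ∈ F.lists (m + (n + i) + 1) z,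
      IncidenceData.cochainFunctional (ℓ i) θ (listBoundary k (Finsupp.single l 1)) =
        ε * IncidenceData.cochainFunctional (ℓ (i + 1)) (δ i θ) (Finsupp.single l 1)) :
    Nonempty ((LinearMap.ker (δ 1) ⧸ (LinearMap.range (δ 0)).submoduleOf (LinearMap.ker (δ 1))) ≃ₗ[k]
      Abelian.Ext M N (n + 1)) := by
  have hproj (i : ℕ) : Projective (ModuleCat.of R (F.rep D (m + i))) := by
    have := IncidenceData.projective_rep_supported D (F.antitone_supported k (m + i)) t
      (ht _ (Nat.le_add_right m i))
    exact (IsProjective.iff_projective _).1 this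
  have : Epi (ModuleCat.ofHom π) := (ModuleCat.epi_iff_surjective _).2 hπ
  let Res : ProjectiveResolution M := ProjectiveResolution.ofExactSequence
    (fun i => ModuleCat.of R (F.rep D (m + i))) (fun i => ModuleCat.ofHom (F.d D (m + i)))
    (ModuleCat.ofHom π)
    (fun i => ModuleCat.hom_ext (LinearMap.ext fun f =>
      (F.exact_d D (m + i)).apply_apply_eq_zero f))
    (ModuleCat.hom_ext (LinearMap.ext fun f => hπd.apply_apply_eq_zero f))
    (fun i => (ShortComplex.ShortExact.moduleCat_exact_iff_function_exact _).2
      (F.exact_d D (m + i)))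
    ((ShortComplex.ShortExact.moduleCat_exact_iff_function_exact _).2 hπd)
  have hd (i : ℕ) : Res.complex.d (i + 1) i = ModuleCat.ofHom (F.d D (m + i)) :=
    ProjectiveResolution.ofExactSequence_d ..
  let e' (i : ℕ) : (J i → k) ≃ₗ[k] (Res.complex.X (n + i) ⟶ N) :=
    LinearEquiv.ofBijective (IncidenceData.cochainHom D _ e (hW i))
      (IncidenceData.cochainHom_bijective D (F.antitone_supported k (m + (n + i))) e (hW i) t
        (ht _ (Nat.le_add_right m _)) (hℓ i) (hℓF i) (hrange i))
  -- Outside `W` both sides vanish. On `W` the identity is linear in `f.1 z` and reduces to `hδ` on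
  -- single lists.
  have he' (i : ℕ) (θ : J i → k) : Res.complex.d (n + i + 1) (n + i) ≫ e' i θ =
      ε • e' (i + 1) (δ i θ) := by
    refine ModuleCat.hom_ext (LinearMap.ext fun f => ?_)
    refine e.symm.injective (IncidenceData.Rep.ext fun z => ?_)
    by_cases hz : z ∈ W
    · have h1 : (e.symm ((Res.complex.d (n + i + 1) (n + i) ≫ e' i θ).hom f)).1 z =
          IncidenceData.cochainFunctional (ℓ i) θ (listBoundary k (f.1 z)) := by
        rw [hd]
        exact IncidenceData.cochainHom_apply D _ e (hW i) θ _ z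
      have h2 : (e.symm ((ε • e' (i + 1) (δ i θ)).hom f)).1 z =
          ε * IncidenceData.cochainFunctional (ℓ (i + 1)) (δ i θ) (f.1 z) := by
        have : (ε • e' (i + 1) (δ i θ)).hom f =
          algebraMap k R ε • (e' (i + 1) (δ i θ)).hom f := rfl
        rw [this, map_smul, algebraMap_smul]
        exact congrArg (ε * ·) (IncidenceData.cochainHom_apply D _ e (hW (i + 1)) (δ i θ) f z)
      rw [h1, h2]
      have hf : f.1 z ∈ Finsupp.supported k k (F.lists (m + (n + i) + 1) z) := f.2 z
      rw [Finsupp.supported_eq_span_single] at hf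
      refine LinearMap.eqOn_span
        (f := IncidenceData.cochainFunctional (ℓ i) θ ∘ₗ listBoundary k)
        (g := ε • IncidenceData.cochainFunctional (ℓ (i + 1)) (δ i θ)) ?_ hf
      rintro _ ⟨l, hl, rfl⟩
      exact hδ i θ z hz l hl
    · have h0 (x : D.Rep (IncidenceData.antitone_indicator (k := k) W)) : x.1 z = 0 := by
        have := x.2 z
        rwa [IncidenceData.indicator_of_notMem hz, Submodule.mem_bot] at this
      rw [h0, h0]
  let u : kˣ := ⟨ε, ε, hε, hε⟩
  exact Res.nonempty_ext_linearEquiv n (δ 0) (δ 1) (e' 0)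
    ((LinearEquiv.smulOfUnit u).trans (e' 1)) (e' 2)
    -- The sign is absorbed by scaling the middle isomorphism by `ε`: the first square then
    -- commutes, and in the second `ε * ε = 1` cancels it.
    (fun x => (map_smul (e' 1) ε (δ 0 x)).trans (he' 0 x).symm)
    (fun x => by
      refine Eq.trans ?_ (he' 1 (ε • x)).symm
      rw [map_smul, map_smul, smul_smul, hε, one_smul])

end ListFamily

/-! ### The presentation of the incidence algebra of an ordered quiver -/

section PathAlgebra

variable (k : Type u) [Field k] {V : Type u} [Quiver.{u} V] [Fintype V] [DecidableEq V]

/-- The representation of the path algebra sending a path to the matrix unit of its endpoints. -/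
noncomputable def pathMatrixLinear : PathAlgebra k V →ₗ[k] Matrix V V k :=
  Finsupp.linearCombination k fun p : AnyPath V => Matrix.single p.1 p.2.1 (1 : k)

theorem pathMatrixLinear_ofPath {x y : V} (p : Quiver.Path x y) :
    pathMatrixLinear k (PathAlgebra.ofPath k p) = Matrix.single x y 1 := by
  unfold pathMatrixLinear PathAlgebra.ofPath
  erw [Finsupp.linearCombination_single, one_smul]

/-- `pathMatrixLinear` as an algebra homomorphism. -/
noncomputable def pathMatrix : PathAlgebra k V →ₐ[k] Matrix V V k :=
  AlgHom.ofLinearMap (pathMatrixLinear k)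
    (by
      rw [PathAlgebra.one_def, map_sum]
      simp only [pathMatrixLinear_ofPath]
      ext x y
      rw [Matrix.sum_apply]
      by_cases h : x = y
      · subst h
        simp [Matrix.single_apply]
      · rw [Matrix.one_apply_ne h]
        refine Finset.sum_eq_zero fun z _ => Matrix.single_apply_of_ne _ _ _ _ _ ?_
        rintro ⟨rfl, rfl⟩
        exact h rfl)
    (by
      have key {y z s t : V} (p : Quiver.Path y z) (q : Quiver.Path s t) :
          pathMatrixLinear k (PathAlgebra.ofPath k p * PathAlgebra.ofPath k q) =
            pathMatrixLinear k (PathAlgebra.ofPath k p) *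
              pathMatrixLinear k (PathAlgebra.ofPath k q) := by
        simp only [pathMatrixLinear_ofPath]
        by_cases hsz : s = z
        · subst hsz
          rw [PathAlgebra.ofPath_mul_ofPath, pathMatrixLinear_ofPath, Matrix.single_mul_single_same,
            one_mul]
        · rw [PathAlgebra.ofPath_mul_ofPath_of_ne k _ _ hsz, map_zero,
            Matrix.single_mul_single_of_ne _ _ _ _ (Ne.symm hsz)]
      have H1 {y z : V} (p : Quiver.Path y z) :
          pathMatrixLinear k ∘ₗ LinearMap.mulLeft k (PathAlgebra.ofPath k p) =
            LinearMap.mulLeft k (pathMatrixLinear k (PathAlgebra.ofPath k p)) ∘ₗ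
              pathMatrixLinear k :=
        PathAlgebra.hom_ext k fun _ _ q => key p q
      intro f g
      have H2 : pathMatrixLinear k ∘ₗ LinearMap.mulRight k g =
            LinearMap.mulRight k (pathMatrixLinear k g) ∘ₗ pathMatrixLinear k :=
        PathAlgebra.hom_ext k fun _ _ p => LinearMap.congr_fun (H1 p) g
      exact LinearMap.congr_fun H2 f)

theorem pathMatrix_ofPath {x y : V} (p : Quiver.Path x y) :
    pathMatrix k (PathAlgebra.ofPath k p) = Matrix.single x y 1 :=
  pathMatrixLinear_ofPath k p

/-- The representation of the incidence algebra by matrices. -/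
noncomputable def incidenceMatrix : QuiverIncidenceAlgebra k V →ₐ[k] Matrix V V k :=
  (parallelIdeal k V).ringCon.liftₐ (pathMatrix k) <| by
    have h : parallelIdeal k V ≤ TwoSidedIdeal.ker (pathMatrix k (V := V)).toRingHom := by
      refine TwoSidedIdeal.span_le.2 ?_
      rintro _ ⟨y, z, p, q, rfl⟩
      refine (TwoSidedIdeal.mem_ker _).2 ?_
      change pathMatrix k (_ - _) = 0
      rw [map_sub, sub_eq_zero, pathMatrix_ofPath, pathMatrix_ofPath]
    exact TwoSidedIdeal.ringCon_le_iff.1 h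

/-- The class of a path in the incidence algebra. -/
noncomputable def pathClass {x y : V} (p : Quiver.Path x y) : QuiverIncidenceAlgebra k V :=
  (parallelIdeal k V).ringCon.mk' (PathAlgebra.ofPath k p)

theorem incidenceMatrix_pathClass {x y : V} (p : Quiver.Path x y) :
    incidenceMatrix k (pathClass k p) = Matrix.single x y 1 :=
  pathMatrix_ofPath k p

omit [DecidableEq V] in
theorem pathClass_eq {x y : V} (p q : Quiver.Path x y) : pathClass k p = pathClass k q := by
  refine (RingCon.eq _).2 ?_
  rw [TwoSidedIdeal.rel_iff]
  exact TwoSidedIdeal.subset_span ⟨x, y, p, q, rfl⟩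

open Classical in
/-- The class of any path between two vertices, zero if there is none. -/
noncomputable def pathElement (x y : V) : QuiverIncidenceAlgebra k V :=
  if h : Nonempty (Quiver.Path x y) then pathClass k h.some else 0

omit [DecidableEq V] in
theorem pathElement_eq {x y : V} (p : Quiver.Path x y) : pathElement k x y = pathClass k p := by
  rw [pathElement, dif_pos ⟨p⟩]
  exact pathClass_eq k _ _

omit [DecidableEq V] in
theorem incidenceAlgebra_mem_span (r : QuiverIncidenceAlgebra k V) :
    r ∈ Submodule.span k
      {r | ∃ x y : V, Nonempty (Quiver.Path x y) ∧ pathElement k x y = r} := by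
  obtain ⟨f, rfl⟩ := (parallelIdeal k V).ringCon.mk'_surjective r
  let φ : PathAlgebra k V →ₗ[k] QuiverIncidenceAlgebra k V :=
    ((parallelIdeal k V).ringCon.mkₐ k).toLinearMap
  let S := Submodule.span k
    {r | ∃ x y : V, Nonempty (Quiver.Path x y) ∧ pathElement k x y = r}
  -- Membership in the span is vanishing in the quotient by it, a linear condition that can be
  -- tested on paths.
  have h : S.mkQ ∘ₗ φ = 0 := PathAlgebra.hom_ext k fun x y p =>
    (Submodule.Quotient.mk_eq_zero S).2 (Submodule.subset_span ⟨x, y, ⟨p⟩, pathElement_eq k p⟩)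
  exact (Submodule.Quotient.mk_eq_zero S).1 (LinearMap.congr_fun h f)

/-- The incidence algebra of a quiver, presented by the order given by paths. -/
noncomputable def quiverIncidenceData [PartialOrder V]
    (hV : ∀ x y : V, x ≤ y ↔ Nonempty (Quiver.Path x y)) :
    IncidenceData k (QuiverIncidenceAlgebra k V) V where
  E := pathElement k
  ρ := incidenceMatrix k
  ρ_E x y h := by
    obtain ⟨p⟩ := (hV x y).1 h
    rw [pathElement_eq k p, incidenceMatrix_pathClass]
  mem_span r := by
    simp only [hV]
    exact incidenceAlgebra_mem_span k r

/-- The trivial path is the only path from `x` to itself, so both sides read off its coefficient.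
This identifies the simple modules in terms of `IncidenceData`. -/
theorem incidenceCharacter_eq [IsOrderedQuiver V] (x : V) (r : QuiverIncidenceAlgebra k V) :
    incidenceCharacter k x r = incidenceMatrix k r x x := by
  classical
  induction incidenceAlgebra_mem_span k r using Submodule.span_induction with
  | mem r hr =>
    obtain ⟨y, z, ⟨p⟩, rfl⟩ := hr
    rw [pathElement_eq k p, incidenceMatrix_pathClass]
    refine (incidenceCharacter_mk_ofPath k x p).trans ?_
    by_cases h : y = x ∧ z = x
    · obtain ⟨rfl, rfl⟩ := h
      rw [IsOrderedQuiver.acyclic z p]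
      simp
    · rw [Matrix.single_apply_of_ne _ _ _ _ _ h, if_neg]
      intro h'
      exact h ⟨congrArg Sigma.fst h', congrArg (fun r : AnyPath V => r.2.1) h'⟩
  | zero => simp
  | add r s _ _ hr hs => simp [hr, hs]
  | smul c r _ hr => simp [hr]

end PathAlgebra

/-! ### The presentation of the enveloping algebra -/

namespace IncidenceData

variable {k : Type*} [Field k] {A : Type*} [Ring A] [Algebra k A] {V : Type*}
  [PartialOrder V] [Fintype V] [DecidableEq V] (D : IncidenceData k A V)

/-- The representation of the opposite algebra by transposed matrices. -/
noncomputable def opMatrix : Aᵐᵒᵖ →ₐ[k] Matrix Vᵒᵈ Vᵒᵈ k :=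
  (Matrix.reindexAlgEquiv k k OrderDual.toDual).toAlgHom.comp
    ((Matrix.transposeAlgEquiv V k k).symm.toAlgHom.comp (AlgHom.op D.ρ))

theorem opMatrix_apply (a : A) (v y : Vᵒᵈ) :
    D.opMatrix (MulOpposite.op a) v y = D.ρ a (OrderDual.ofDual y) (OrderDual.ofDual v) := rfl

/-- The representation of the enveloping algebra by Kronecker products. -/
noncomputable def envelopingMatrix : A ⊗[k] Aᵐᵒᵖ →ₐ[k] Matrix (V × Vᵒᵈ) (V × Vᵒᵈ) k :=
  (Matrix.kroneckerAlgEquiv V Vᵒᵈ k).toAlgHom.comp (Algebra.TensorProduct.map D.ρ D.opMatrix)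

theorem envelopingMatrix_tmul (a b : A) (z w : V × Vᵒᵈ) :
    D.envelopingMatrix (a ⊗ₜ MulOpposite.op b) z w =
      D.ρ a z.1 w.1 * D.ρ b (OrderDual.ofDual w.2) (OrderDual.ofDual z.2) := by
  rw [← opMatrix_apply]
  rfl

/-- The enveloping algebra of an incidence algebra is the incidence algebra of the product of the
poset with its dual. -/
noncomputable def enveloping : IncidenceData k (A ⊗[k] Aᵐᵒᵖ) (V × Vᵒᵈ) where
  E z w := D.E z.1 w.1 ⊗ₜ MulOpposite.op (D.E (OrderDual.ofDual w.2) (OrderDual.ofDual z.2))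
  ρ := D.envelopingMatrix
  ρ_E z w h := by
    ext x y
    rw [envelopingMatrix_tmul, D.ρ_E _ _ h.1,
      D.ρ_E _ _ (OrderDual.ofDual_le_ofDual.2 h.2)]
    obtain ⟨z1, z2⟩ := z
    obtain ⟨w1, w2⟩ := w
    obtain ⟨x1, x2⟩ := x
    obtain ⟨y1, y2⟩ := y
    simp only [Matrix.single_apply, Prod.mk.injEq, EmbeddingLike.apply_eq_iff_eq]
    split_ifs <;> simp_all
  mem_span r := by
    induction r using TensorProduct.induction_on with
    | zero => exact zero_mem _
    | add r s hr hs => exact add_mem hr hs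
    | tmul a b =>
      obtain ⟨b, rfl⟩ := MulOpposite.op_surjective b
      induction D.mem_span a using Submodule.span_induction with
      | mem a ha =>
        obtain ⟨u, x, hux, rfl⟩ := ha
        induction D.mem_span b using Submodule.span_induction with
        | mem b hb =>
          obtain ⟨y, v, hyv, rfl⟩ := hb
          exact Submodule.subset_span ⟨(u, OrderDual.toDual v), (x, OrderDual.toDual y),
            ⟨hux, hyv⟩, rfl⟩
        | zero => rw [MulOpposite.op_zero, TensorProduct.tmul_zero]; exact zero_mem _
        | add b b' _ _ hb hb' =>
          rw [MulOpposite.op_add, TensorProduct.tmul_add]; exact add_mem hb hb'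
        | smul c b _ hb =>
          rw [MulOpposite.op_smul, TensorProduct.tmul_smul]; exact Submodule.smul_mem _ c hb
      | zero => rw [TensorProduct.zero_tmul]; exact zero_mem _
      | add a a' _ _ ha ha' => rw [TensorProduct.add_tmul]; exact add_mem ha ha'
      | smul c a _ ha => rw [← TensorProduct.smul_tmul']; exact Submodule.smul_mem _ c ha

end IncidenceData

/-! ### The cochain complex of the order complex -/

/-- The sorted lists of length `i + 1`, i.e. the `i`-simplices of the order complex. -/
abbrev Simplex (V : Type u) [PartialOrder V] (i : ℕ) : Type u :=
  {l : List V // l ∈ sortedLists (Set.univ : Set V) (i + 1)}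

/-- The coboundary map of the order complex. -/
noncomputable def coboundary (k : Type u) [Field k] (V : Type u) [PartialOrder V] (i : ℕ) :
    (Simplex V i → k) →ₗ[k] (Simplex V (i + 1) → k) where
  toFun θ l := IncidenceData.cochainFunctional Subtype.val θ
    (listBoundary k (Finsupp.single l.1 1))
  map_add' θ θ' := funext fun l => by
    rw [map_add]
    rfl
  map_smul' c θ := funext fun l => by
    rw [map_smul]
    rfl

/-- The cohomology of the order complex in degree `i + 1`. -/
abbrev OrderCohomology (k : Type u) [Field k] (V : Type u) [PartialOrder V] (i : ℕ) : Type u :=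
  LinearMap.ker (coboundary k V (i + 1)) ⧸
    (LinearMap.range (coboundary k V i)).submoduleOf (LinearMap.ker (coboundary k V (i + 1)))

/-! ### Hochschild cohomology -/

section Hochschild

/-- The lists with entries in the interval from `u` to `v`. -/
def intervalFamily (V : Type*) [PartialOrder V] : ListFamily (V × Vᵒᵈ) V where
  S z := Set.Icc z.1 (OrderDual.ofDual z.2)
  U := ⟨{z | z.1 ≤ OrderDual.ofDual z.2}, fun _ _ h hw =>
    h.1.trans (le_trans hw (OrderDual.ofDual_le_ofDual.2 h.2))⟩
  antitone_S _ _ h := Set.Icc_subset_Icc h.1 h.2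
  exists_isLeast z hz := Or.inr ⟨z.1, isLeast_Icc hz⟩

/-- The pair of the first and the last entry of a list. -/
noncomputable def listEnds (V : Type*) [Nonempty V] : List V → V × Vᵒᵈ
  | [] => Classical.arbitrary _
  | x :: l => (x, OrderDual.toDual ((x :: l).getLast (List.cons_ne_nil x l)))

/-- A nonempty sorted list lies in `[u, v]` as soon as its first entry is at least `u` and its last
at most `v`. The empty list has no such bounding pair in general, so the resolution starts with
length one. -/
theorem mem_intervalFamily_lists_iff {V : Type*} [PartialOrder V] [Nonempty V] {n : ℕ} {l : List V}
    (hl : l ∈ sortedLists Set.univ (n + 1)) (z : V × Vᵒᵈ) :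
    l ∈ (intervalFamily V).lists (n + 1) z ↔ z ≤ listEnds V l := by
  cases l with
  | nil => simpa using hl.1
  | cons x l =>
    have hx : ∀ y ∈ x :: l, x ≤ y := by
      intro y hy
      rcases List.mem_cons.1 hy with rfl | hy
      · exact le_rfl
      · exact ((List.pairwise_cons.1 hl.2.1).1 y hy).le
    have hlast : ∀ y ∈ x :: l, y ≤ (x :: l).getLast (List.cons_ne_nil x l) := by
      intro y hy
      exact (hl.2.1.imp le_of_lt).rel_getLast hy
    constructor
    · intro h
      exact ⟨(h.1.2.2 x List.mem_cons_self).1,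
        (h.1.2.2 _ (List.getLast_mem (List.cons_ne_nil x l))).2⟩
    · intro h
      have h2 : (x :: l).getLast (List.cons_ne_nil x l) ≤ OrderDual.ofDual z.2 := h.2
      exact ⟨⟨hl.1, hl.2.1, fun y hy => ⟨h.1.trans (hx y hy), (hlast y hy).trans h2⟩⟩,
        h.1.trans ((hx _ (List.getLast_mem (List.cons_ne_nil x l))).trans h2)⟩

theorem mem_sortedLists_of_mem_lists {V Z : Type*} [PartialOrder V] [PartialOrder Z]
    {F : ListFamily Z V} {n : ℕ} {l : List V} {z : Z} (hl : l ∈ F.lists n z) :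
    l ∈ sortedLists Set.univ n :=
  sortedLists_mono (Set.subset_univ _) n hl.1

variable {k : Type u} [Field k] {A : Type u} [Ring A] [Algebra k A] {V : Type u}
  [PartialOrder V] [Fintype V] [DecidableEq V] (D : IncidenceData k A V)

attribute [local instance] instModuleTensorProductMop

/-- The representation on the regular bimodule given by the matrix entries. -/
noncomputable def bimoduleToRep : A →ₗ[A ⊗[k] Aᵐᵒᵖ]
    D.enveloping.Rep (IncidenceData.antitone_indicator (k := k) (intervalFamily V).U) where
  toFun a := ⟨fun z => D.ρ a z.1 (OrderDual.ofDual z.2), fun z => by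
    by_cases hz : z ∈ (intervalFamily V).U
    · rw [IncidenceData.indicator_of_mem hz]; trivial
    · have h0 : D.ρ a z.1 (OrderDual.ofDual z.2) = 0 := D.ρ_apply_of_not_le a hz
      change D.ρ a z.1 (OrderDual.ofDual z.2) ∈ _
      rw [h0]
      exact zero_mem _⟩
  map_add' a b := IncidenceData.Rep.ext fun z => by
    change D.ρ (_ + _) _ _ = D.ρ _ _ _ + D.ρ _ _ _
    rw [map_add, Matrix.add_apply]
  map_smul' r a := by
    -- The entries of a triple product: `(bac)_{uv} = ∑ b_{ux} a_{xy} c_{yv}`, with `(x, y)` as the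
    -- summation index `w`.
    have key (b c : A) (z : V × Vᵒᵈ) : D.ρ (b * (a * c)) z.1 (OrderDual.ofDual z.2) =
        ∑ w : V × Vᵒᵈ, D.envelopingMatrix (b ⊗ₜ MulOpposite.op c) z w •
          D.ρ a w.1 (OrderDual.ofDual w.2) := by
      simp only [IncidenceData.envelopingMatrix_tmul, map_mul, Matrix.mul_apply,
        Fintype.sum_prod_type, Finset.mul_sum, smul_eq_mul]
      refine Finset.sum_congr rfl fun x _ => ?_
      refine Finset.sum_equiv OrderDual.toDual (by simp) fun y _ => ?_
      simp only [OrderDual.ofDual_toDual]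
      ring
    induction r using TensorProduct.induction_on with
    | zero =>
      rw [← TensorProduct.zero_tmul A (0 : Aᵐᵒᵖ)]
      exact IncidenceData.Rep.ext (key 0 0)
    | add r s hr hs =>
      refine Eq.trans (IncidenceData.Rep.ext fun z => ?_)
        ((congrArg₂ (· + ·) hr hs).trans (add_smul r s _).symm)
      change D.ρ ((r + s) • a) z.1 (OrderDual.ofDual z.2) =
        D.ρ (r • a) z.1 (OrderDual.ofDual z.2) + D.ρ (s • a) z.1 (OrderDual.ofDual z.2)
      rw [add_smul, map_add]
      rfl
    | tmul b c => exact IncidenceData.Rep.ext (key b c.unop)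

theorem bimoduleToRep_bijective : Function.Bijective (bimoduleToRep D) := by
  constructor
  · intro a b h
    refine D.ρ_injective (Matrix.ext fun u v => ?_)
    exact congrArg (fun f => f.1 (u, OrderDual.toDual v)) h
  · intro g
    -- The preimage is the element with matrix entries `g`. As `g` vanishes off the order relation,
    -- the values of `E` there are irrelevant.
    refine ⟨(∑ u, ∑ v, g.1 (u, OrderDual.toDual v) • D.E u v : A), ?_⟩
    refine IncidenceData.Rep.ext fun ⟨x, y⟩ => ?_
    change D.ρ (∑ u, ∑ v, g.1 (u, OrderDual.toDual v) • D.E u v : A) x (OrderDual.ofDual y) = _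
    have (u v : V) : D.ρ (g.1 (u, OrderDual.toDual v) • D.E u v) =
        Matrix.single u v (g.1 (u, OrderDual.toDual v)) := by
      by_cases h : u ≤ v
      · rw [map_smul, D.ρ_E u v h, Matrix.smul_single, smul_eq_mul, mul_one]
      · have := g.2 (u, OrderDual.toDual v)
        rw [IncidenceData.indicator_of_notMem h, Submodule.mem_bot] at this
        rw [this, zero_smul, map_zero, Matrix.single_zero]
    simp only [map_sum, this, Matrix.sum_apply]
    rw [Finset.sum_eq_single x, Finset.sum_eq_single (OrderDual.ofDual y)]
    · simp
    · intro v _ hv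
      exact Matrix.single_apply_of_ne _ _ _ _ _ fun h => hv h.2
    · simp
    · intro u _ hu
      exact Finset.sum_eq_zero fun v _ => Matrix.single_apply_of_ne _ _ _ _ _ fun h => hu h.1
    · simp

/-- The regular bimodule as a representation. -/
noncomputable def repEquivBimodule :
    D.enveloping.Rep (IncidenceData.antitone_indicator (k := k) (intervalFamily V).U)
      ≃ₗ[A ⊗[k] Aᵐᵒᵖ] A :=
  (LinearEquiv.ofBijective (bimoduleToRep D) (bimoduleToRep_bijective D)).symm

/-- The augmentation of the lists of length one. -/
noncomputable def listAugmentation (k : Type*) [Field k] (X : Type*) : (List X →₀ k) →ₗ[k] k :=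
  Finsupp.lapply [] ∘ₗ listBoundary k

/-- The augmentation of the resolution, as a map to the representation of the lower set. -/
noncomputable def repAugmentation : (intervalFamily V).rep D.enveloping 1 →ₗ[A ⊗[k] Aᵐᵒᵖ]
    D.enveloping.Rep (IncidenceData.antitone_indicator (k := k) (intervalFamily V).U) :=
  IncidenceData.Rep.map D.enveloping _ _ (listAugmentation k V) fun z h hh => by
    by_cases hz : z ∈ (intervalFamily V).U
    · rw [IncidenceData.indicator_of_mem hz]; trivial
    · rw [(intervalFamily V).eq_zero_of_notMem hz hh, map_zero]; exact zero_mem _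

theorem repAugmentation_surjective : Function.Surjective (repAugmentation D) := by
  intro g
  -- The one-entry list `[z.1]`, the bottom of the interval, has augmentation one.
  refine ⟨⟨fun z => g.1 z • Finsupp.single [z.1] 1, fun z => ?_⟩, ?_⟩
  · by_cases hz : z ∈ (intervalFamily V).U
    · refine Submodule.smul_mem _ _ (Finsupp.single_mem_supported k 1 ⟨⟨rfl, ?_, ?_⟩, hz⟩)
      · simp
      · intro x hx
        rw [List.mem_singleton.1 hx]
        exact (isLeast_Icc hz).1
    · have := g.2 z
      rw [IncidenceData.indicator_of_notMem hz, Submodule.mem_bot] at this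
      change g.1 z • Finsupp.single [z.1] 1 ∈ _
      rw [this, zero_smul]
      exact zero_mem _
  · refine IncidenceData.Rep.ext fun z => ?_
    change listAugmentation k V (g.1 z • Finsupp.single [z.1] 1) = g.1 z
    rw [map_smul, listAugmentation, LinearMap.comp_apply, listBoundary_single_cons,
      listBoundary_single_nil, map_zero, sub_zero]
    simp

theorem listAugmentation_eq_zero_iff {X : Type*} [PartialOrder X] {S : Set X} {h : List X →₀ k}
    (hh : h ∈ Finsupp.supported k k (sortedLists S 1)) :
    listAugmentation k X h = 0 ↔ listBoundary k h = 0 := by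
  constructor
  · intro h0
    refine Finsupp.ext fun l => ?_
    by_cases hl : l = []
    · subst hl; exact h0
    · by_contra hne
      exact hl (List.length_eq_zero_iff.1
        (listBoundary_mem_supported k hh (Finsupp.mem_support_iff.2 hne)).1)
  · intro h0
    rw [listAugmentation, LinearMap.comp_apply, h0, map_zero]

/-- The boundary of a combination of one-entry lists is a multiple of the empty list, and the
augmentation is its coefficient. Thus the kernel is that of the boundary map to lists of length
zero, where exactness is known. -/
theorem exact_repAugmentation :
    Function.Exact ((intervalFamily V).d D.enveloping 1) (repAugmentation D) := by
  intro f
  rw [← (intervalFamily V).exact_d D.enveloping 0 f]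
  have h (z : V × Vᵒᵈ) : listAugmentation k V (f.1 z) = 0 ↔ listBoundary k (f.1 z) = 0 :=
    listAugmentation_eq_zero_iff (Finsupp.supported_mono (fun _ hl => hl.1) (f.2 z))
  constructor
  · intro hf
    exact IncidenceData.Rep.ext fun z => (h z).1 (congrArg (fun g => g.1 z) hf)
  · intro hf
    exact IncidenceData.Rep.ext fun z => (h z).2 (congrArg (fun g => g.1 z) hf)

theorem nonempty_orderCohomology_equiv_hochschild_of_isEmpty [IsEmpty V]
    (D : IncidenceData k A V) (n : ℕ) :
    Nonempty (OrderCohomology k V n ≃ₗ[k]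
      HochschildCohomology k A (regularBimodule k A) (n + 1)) := by
  have hA : Subsingleton A := subsingleton_of_forall_eq 0 fun r => by
    rw [D.eq_sum r, Finset.univ_eq_empty, Finset.sum_empty]
  have hproj : Projective (regularBimodule k A) :=
    (IsProjective.iff_projective (R := A ⊗[k] Aᵐᵒᵖ) A).1 inferInstance
  have h1 : Subsingleton (HochschildCohomology k A (regularBimodule k A) (n + 1)) :=
    Abelian.Ext.subsingleton_of_projective _ _ _
  have h2 : IsEmpty (Simplex V (n + 1)) := ⟨fun ⟨l, hl⟩ => by
    cases l with
    | nil => simpa using hl.1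
    | cons x l => exact isEmptyElim x⟩
  have h3 : Subsingleton (OrderCohomology k V n) :=
    (Submodule.mkQ_surjective _).subsingleton
  exact ⟨0, 0, fun _ => Subsingleton.elim _ _, fun _ => Subsingleton.elim _ _⟩

/-- The Hochschild cohomology of an incidence algebra is the cohomology of the order complex. -/
theorem nonempty_orderCohomology_equiv_hochschild (D : IncidenceData k A V) (n : ℕ) :
    Nonempty (OrderCohomology k V n ≃ₗ[k]
      HochschildCohomology k A (regularBimodule k A) (n + 1)) := by
  rcases isEmpty_or_nonempty V with hV | hV
  · exact nonempty_orderCohomology_equiv_hochschild_of_isEmpty D n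
  have hmem (i : ℕ) (l : List V) (z : V × Vᵒᵈ)
      (h : l ∈ (intervalFamily V).lists (1 + (n + i)) z) :
      l ∈ sortedLists Set.univ (n + i + 1) := by
    rw [Nat.add_comm 1] at h
    exact mem_sortedLists_of_mem_lists h
  -- Resolution degree `n + i` consists of lists of length `1 + (n + i)`, the `(n + i)`-simplices.
  -- Here `W` is all of `U`, so no list is discarded, and the sign is `1`.
  refine (intervalFamily V).nonempty_ext_linearEquiv D.enveloping 1 (listEnds V) ?_
    ((repEquivBimodule D).toLinearMap ∘ₗ repAugmentation D)
    ((repEquivBimodule D).surjective.comp (repAugmentation_surjective D)) ?_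
    (repEquivBimodule D) n (J := fun i => Simplex V (n + i)) (fun i => Subtype.val)
    (fun i => Subtype.val_injective) ?_ ?_ ?_ (fun i => coboundary k V (n + i)) 1 (one_mul 1) ?_
  · rintro n hn l z hl
    obtain ⟨n, rfl⟩ := Nat.exists_eq_add_of_le' hn
    exact mem_intervalFamily_lists_iff (mem_sortedLists_of_mem_lists hl)
  · intro f
    rw [← exact_repAugmentation D f]
    exact (repEquivBimodule D).map_eq_zero_iff
  · rintro i ⟨l, hl⟩
    refine ⟨listEnds V l, ?_⟩
    rw [Nat.add_comm 1]
    exact (mem_intervalFamily_lists_iff hl _).2 le_rfl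
  · exact fun i j z h => h.2
  · exact fun i l z h _ => ⟨⟨l, hmem i l z h⟩, rfl⟩
  · intro i θ z _ l hl
    rw [one_mul]
    exact (IncidenceData.cochainFunctional_single Subtype.val_injective (coboundary k V (n + i) θ)
      (⟨l, hmem (i + 1) l z hl⟩ : Simplex V (n + (i + 1)))).symm

end Hochschild

/-! ### The suspension -/

theorem listBoundary_map {k : Type*} [Field k] {X Y : Type*} (g : X → Y) (h : List X →₀ k) :
    listBoundary k (Finsupp.lmapDomain k k (List.map g) h) =
      Finsupp.lmapDomain k k (List.map g) (listBoundary k h) := by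
  have : listBoundary k ∘ₗ Finsupp.lmapDomain k k (List.map g) =
      Finsupp.lmapDomain k k (List.map g) ∘ₗ listBoundary k := by
    refine Finsupp.lhom_ext' fun l => LinearMap.ext_ring ?_
    change listBoundary k (Finsupp.lmapDomain k k (List.map g) (Finsupp.single l 1)) =
      Finsupp.lmapDomain k k (List.map g) (listBoundary k (Finsupp.single l 1))
    have hs (l : List X) : Finsupp.lmapDomain k k (List.map g) (Finsupp.single l 1) =
        Finsupp.single (l.map g) 1 := by simp
    have hc (x : X) (h : List X →₀ k) : Finsupp.lmapDomain k k (List.map g)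
        (Finsupp.lmapDomain k k (List.cons x) h) = Finsupp.lmapDomain k k (List.cons (g x))
          (Finsupp.lmapDomain k k (List.map g) h) := by
      simp only [Finsupp.lmapDomain_apply, ← Finsupp.mapDomain_comp]
      rfl
    rw [hs]
    induction l with
    | nil => rw [List.map_nil, listBoundary_single_nil, listBoundary_single_nil, map_zero]
    | cons x l ih =>
      rw [List.map_cons, listBoundary_single_cons, listBoundary_single_cons, map_sub, hs, hc, ih]
  exact LinearMap.congr_fun this h

namespace IncidenceData

theorem cochainFunctional_lmapDomain {k : Type u} [Field k] {B B' J : Type u} (ℓ : J → B)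
    {g : B → B'} (hg : Function.Injective g) (θ : J → k) (h : B →₀ k) :
    cochainFunctional (g ∘ ℓ) θ (Finsupp.lmapDomain k k g h) = cochainFunctional ℓ θ h := by
  have : cochainFunctional (g ∘ ℓ) θ ∘ₗ Finsupp.lmapDomain k k g = cochainFunctional ℓ θ := by
    refine Finsupp.lhom_ext' fun l => LinearMap.ext_ring ?_
    have : Function.extend (g ∘ ℓ) θ 0 (g l) = Function.extend ℓ θ 0 l := by
      classical
      by_cases hl : ∃ j, ℓ j = l
      · have hl' : ∃ j, (g ∘ ℓ) j = g l := hl.imp fun j hj => congrArg g hj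
        simp only [Function.extend, dif_pos hl, dif_pos hl']
        congr 2
        funext j
        exact propext hg.eq_iff
      · have hl' : ¬ ∃ j, (g ∘ ℓ) j = g l := fun ⟨j, hj⟩ => hl ⟨j, hg hj⟩
        rw [Function.extend_apply' _ _ _ hl, Function.extend_apply' _ _ _ hl']
        rfl
    simpa [cochainFunctional] using this
  exact LinearMap.congr_fun this h

end IncidenceData

/-! ### The path order on an ordered quiver and its suspension -/

section PathOrder

/-- The order on the vertices of an ordered quiver given by the paths. -/
@[reducible] def pathOrder (V : Type u) [Quiver.{u} V] [Finite V] [IsOrderedQuiver V] :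
    PartialOrder V where
  le x y := Nonempty (Quiver.Path x y)
  le_refl _ := ⟨Quiver.Path.nil⟩
  le_trans _ _ _ := fun ⟨p⟩ ⟨q⟩ => ⟨p.comp q⟩
  le_antisymm x y := fun ⟨p⟩ ⟨q⟩ => by
    have h := congrArg Quiver.Path.length (IsOrderedQuiver.acyclic x (p.comp q))
    rw [Quiver.Path.length_comp, Quiver.Path.length_nil] at h
    exact Quiver.Path.eq_of_length_zero p (by omega)

namespace Suspension

variable {V : Type u} [Quiver.{u} V]

theorem nonempty_path_of_of {x y : V} :
    Nonempty (Quiver.Path (of x) (of y)) ↔ Nonempty (Quiver.Path x y) := by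
  constructor
  · rintro ⟨p⟩
    obtain ⟨q, -⟩ := path_of p
    exact ⟨q⟩
  · rintro ⟨p⟩
    exact ⟨inclusion.mapPath p⟩

/-- A vertex that is not a source has a strictly smaller predecessor; by finiteness, descending
reaches a source, which receives an arrow from `b`. -/
theorem nonempty_path_b_of [Finite V] [IsOrderedQuiver V] (x : V) :
    Nonempty (Quiver.Path (Suspension.b : Suspension V) (of x)) := by
  let := pathOrder V
  induction x using WellFoundedLT.induction with
  | ind x ih =>
    by_cases hx : IsSourceVertex x
    · exact ⟨Quiver.Hom.toPath (Suspension.Arrow.toSource x hx : b ⟶ of x)⟩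
    · simp only [IsSourceVertex, not_forall, not_isEmpty_iff] at hx
      obtain ⟨y, ⟨α⟩⟩ := hx
      have hyx : y < x := by
        refine lt_of_le_of_ne ⟨α.toPath⟩ ?_
        rintro rfl
        have h := congrArg Quiver.Path.length (IsOrderedQuiver.acyclic y α.toPath)
        simp at h
      obtain ⟨p⟩ := ih y hyx
      exact ⟨p.comp (inclusion.mapPath α.toPath)⟩

theorem nonempty_path_of_a [Finite V] [IsOrderedQuiver V] (x : V) :
    Nonempty (Quiver.Path (of x) (Suspension.a : Suspension V)) := by
  let := pathOrder V
  induction x using WellFoundedGT.induction with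
  | ind x ih =>
    by_cases hx : IsSinkVertex x
    · exact ⟨Quiver.Hom.toPath (Suspension.Arrow.fromSink x hx : of x ⟶ a)⟩
    · simp only [IsSinkVertex, not_forall, not_isEmpty_iff] at hx
      obtain ⟨y, ⟨α⟩⟩ := hx
      have hxy : x < y := by
        refine lt_of_le_of_ne ⟨α.toPath⟩ ?_
        rintro rfl
        have h := congrArg Quiver.Path.length (IsOrderedQuiver.acyclic x α.toPath)
        simp at h
      obtain ⟨p⟩ := ih y hxy
      exact ⟨(inclusion.mapPath α.toPath).comp p⟩

end Suspension

end PathOrder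

/-- An order on the suspension of a poset in which the new vertices `b` and `a` lie below and above
the elements of the poset. -/
structure IsSuspensionOrder (V : Type u) [PartialOrder V] [PartialOrder (Suspension V)] :
    Prop where
  of_le_of {x y : V} : Suspension.of x ≤ Suspension.of y ↔ x ≤ y
  b_le_of (x : V) : Suspension.b ≤ Suspension.of x
  of_le_a (x : V) : Suspension.of x ≤ Suspension.a
  le_b {z : Suspension V} : z ≤ Suspension.b → z = Suspension.b
  a_le {z : Suspension V} : Suspension.a ≤ z → z = Suspension.a

theorem isSuspensionOrder_pathOrder (V : Type u) [Quiver.{u} V] [Finite V] [IsOrderedQuiver V] :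
    @IsSuspensionOrder V (pathOrder V) (pathOrder (Suspension V)) :=
  letI := pathOrder V
  letI := pathOrder (Suspension V)
  { of_le_of := Suspension.nonempty_path_of_of
    b_le_of := Suspension.nonempty_path_b_of
    of_le_a := Suspension.nonempty_path_of_a
    le_b := fun ⟨p⟩ => Quiver.Path.eq_of_length_zero p (Suspension.path_b p)
    a_le := fun ⟨p⟩ => (Suspension.path_a p).1 }

namespace IsSuspensionOrder

variable {V : Type u} [PartialOrder V] [PartialOrder (Suspension V)] (hV : IsSuspensionOrder V)

include hV

theorem of_lt_of {x y : V} : Suspension.of x < Suspension.of y ↔ x < y := by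
  rw [lt_iff_le_not_ge, lt_iff_le_not_ge, hV.of_le_of, hV.of_le_of]

theorem b_lt_of (x : V) : Suspension.b < Suspension.of x :=
  lt_of_le_of_ne (hV.b_le_of x) fun h => nomatch h

theorem of_lt_a (x : V) : Suspension.of x < Suspension.a :=
  lt_of_le_of_ne (hV.of_le_a x) fun h => nomatch h

end IsSuspensionOrder

theorem Suspension.exists_of_eq {V : Type u} [PartialOrder (Suspension V)] {z : Suspension V} (h1 : Suspension.b < z) (h2 : z < Suspension.a) :
    ∃ x, Suspension.of x = z := by
  cases z with
  | of x => exact ⟨x, rfl⟩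
  | a => exact (lt_irrefl _ h2).elim
  | b => exact (lt_irrefl _ h1).elim

/-- The lists with entries in the interval from a given vertex to `a`, without `a`. -/
def belowFamily (V : Type u) [PartialOrder (Suspension V)] :
    ListFamily (Suspension V) (Suspension V) where
  S z := Set.Ico z Suspension.a
  U := LowerSet.Iic Suspension.a
  antitone_S _ _ h := Set.Ico_subset_Ico_left h
  exists_isLeast z hz := by
    rcases lt_or_eq_of_le (LowerSet.mem_Iic_iff.1 hz) with h | h
    · exact Or.inr ⟨z, isLeast_Ico h⟩
    · exact Or.inl (by rw [h, Set.Ico_self])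

/-- The first entry of a list, and `a` for the empty list. -/
def listHead (V : Type u) : List (Suspension V) → Suspension V
  | [] => Suspension.a
  | z :: _ => z

/-- Sortedness reduces the lower bound to the first entry. The empty list occurs throughout `U`,
whose greatest element is `a`, so here lists of length zero can be included. -/
theorem mem_belowFamily_lists_iff {V : Type u} [PartialOrder (Suspension V)] {n : ℕ}
    {l : List (Suspension V)} {z : Suspension V} (hl : l ∈ (belowFamily V).lists n z)
    (w : Suspension V) : l ∈ (belowFamily V).lists n w ↔ w ≤ listHead V l := by
  cases l with
  | nil => exact ⟨fun h => h.2, fun h => ⟨⟨hl.1.1, List.Pairwise.nil, by simp⟩, h⟩⟩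
  | cons x l =>
    constructor
    · intro h
      exact (h.1.2.2 x List.mem_cons_self).1
    · intro h
      refine ⟨⟨hl.1.1, hl.1.2.1, fun y hy => ⟨?_, (hl.1.2.2 y hy).2⟩⟩,
        h.trans (hl.1.2.2 x List.mem_cons_self).2.le⟩
      rcases List.mem_cons.1 hy with rfl | hy
      · exact h
      · exact h.trans ((List.pairwise_cons.1 hl.1.2.1).1 y hy).le

/-- The list starting with `b` given by a list in the poset. -/
def suspendList {V : Type u} (l : List V) : List (Suspension V) :=
  Suspension.b :: l.map Suspension.of

theorem suspendList_injective {V : Type u} : Function.Injective (suspendList (V := V)) := by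
  intro l l' h
  refine List.map_injective_iff.2 ?_ (List.tail_eq_of_cons_eq h)
  exact fun x y h => Suspension.of.inj h

section

variable {V : Type u} [PartialOrder V] [PartialOrder (Suspension V)] (hV : IsSuspensionOrder V)
include hV

theorem suspendList_mem {n : ℕ} {l : List V} (hl : l ∈ sortedLists Set.univ (n + 1)) :
    suspendList l ∈ (belowFamily V).lists (n + 2) Suspension.b := by
  have hba : (Suspension.b : Suspension V) < Suspension.a := by
    cases l with
    | nil => simpa using hl.1
    | cons x l => exact (hV.b_lt_of x).trans (hV.of_lt_a x)
  refine ⟨⟨?_, List.pairwise_cons.2 ⟨?_, ?_⟩, ?_⟩, hba.le⟩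
  · rw [suspendList, List.length_cons, List.length_map, hl.1]
  · intro z hz
    obtain ⟨x, _, rfl⟩ := List.mem_map.1 hz
    exact hV.b_lt_of x
  · exact List.pairwise_map.2 (hl.2.1.imp hV.of_lt_of.2)
  · intro z hz
    rcases List.mem_cons.1 hz with rfl | hz
    · exact ⟨le_rfl, hba⟩
    · obtain ⟨x, _, rfl⟩ := List.mem_map.1 hz
      exact ⟨hV.b_le_of x, hV.of_lt_a x⟩

/-- The entries after `b` lie strictly between `b` and `a`, hence come from `V`. -/
theorem exists_suspendList_eq {n : ℕ} {l : List (Suspension V)} {z : Suspension V}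
    (hl : l ∈ (belowFamily V).lists (n + 2) z) (h : listHead V l = Suspension.b) :
    ∃ l' ∈ sortedLists (Set.univ : Set V) (n + 1), suspendList l' = l := by
  cases l with
  | nil => exact nomatch h
  | cons w l =>
    obtain rfl : w = Suspension.b := h
    have hl' := List.pairwise_cons.1 hl.1.2.1
    obtain ⟨l', rfl⟩ : ∃ l', List.map Suspension.of l' = l := by
      have : l ∈ Set.range (List.map (Suspension.of (V := V))) := by
        rw [Set.range_list_map]
        exact fun y hy => Suspension.exists_of_eq (hl'.1 y hy) (hl.1.2.2 y (List.mem_cons_of_mem _ hy)).2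
      exact this
    refine ⟨l', ⟨?_, ?_, fun _ _ => trivial⟩, rfl⟩
    · have := hl.1.1
      rw [List.length_cons, List.length_map] at this
      omega
    · exact (List.pairwise_map.1 hl'.2).imp hV.of_lt_of.1

end

section

variable {k : Type u} [Field k] {V : Type u} [PartialOrder V] [PartialOrder (Suspension V)]
  (hV : IsSuspensionOrder V)
include hV

/-- Deleting `b` leaves a list on which the cochain vanishes. The other faces are those of the chain
in `V`, moved one position to the right, which costs the sign `-1`. A list without `b` contributes
zero on both sides. -/
theorem cochainFunctional_suspendList (n i : ℕ) (θ : Simplex V (n + i) → k) {l : List (Suspension V)}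
    (hl : l ∈ (belowFamily V).lists (n + i + 3) Suspension.b) :
    IncidenceData.cochainFunctional (fun j : Simplex V (n + i) => suspendList j.1) θ
        (listBoundary k (Finsupp.single l 1)) =
      -1 * IncidenceData.cochainFunctional (fun j : Simplex V (n + (i + 1)) => suspendList j.1)
        (coboundary k V (n + i) θ) (Finsupp.single l 1) := by
  have hnot {h : List (Suspension V) →₀ k}
      (hh : h ∈ Finsupp.supported k k {l | Suspension.b ∉ l}) :
      IncidenceData.cochainFunctional (fun j : Simplex V (n + i) => suspendList j.1) θ h = 0 := by
    rw [Finsupp.supported_eq_span_single] at hh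
    refine LinearMap.eqOn_span (g := 0) ?_ hh
    rintro _ ⟨l, hl, rfl⟩
    refine IncidenceData.cochainFunctional_single_of_notMem θ ?_
    rintro ⟨j, rfl⟩
    exact hl List.mem_cons_self
  by_cases hb : listHead V l = Suspension.b
  · obtain ⟨l, hl', rfl⟩ := exists_suspendList_eq hV hl hb
    have hmap : Finsupp.single (l.map Suspension.of) (1 : k) =
        Finsupp.lmapDomain k k (List.map Suspension.of) (Finsupp.single l 1) := by simp
    have h1 : IncidenceData.cochainFunctional (fun j : Simplex V (n + i) => suspendList j.1) θ
        (Finsupp.lmapDomain k k suspendList (listBoundary k (Finsupp.single l 1))) =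
          IncidenceData.cochainFunctional Subtype.val θ (listBoundary k (Finsupp.single l 1)) :=
      IncidenceData.cochainFunctional_lmapDomain Subtype.val suspendList_injective θ _
    have h2 : IncidenceData.cochainFunctional
        (fun j : Simplex V (n + (i + 1)) => suspendList j.1) (coboundary k V (n + i) θ)
          (Finsupp.single (suspendList l) 1) = coboundary k V (n + i) θ ⟨l, hl'⟩ :=
      IncidenceData.cochainFunctional_single
        (suspendList_injective.comp Subtype.val_injective) (coboundary k V (n + i) θ)
        (⟨l, hl'⟩ : Simplex V (n + (i + 1)))
    have h3 (h : List V →₀ k) : Finsupp.lmapDomain k k (List.cons Suspension.b)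
        (Finsupp.lmapDomain k k (List.map Suspension.of) h) =
          Finsupp.lmapDomain k k suspendList h := by
      simp only [Finsupp.lmapDomain_apply, ← Finsupp.mapDomain_comp]
      rfl
    rw [h2, suspendList, listBoundary_single_cons, map_sub, hmap, listBoundary_map, h3, h1, ← hmap,
      hnot (Finsupp.single_mem_supported k 1 (by simp))]
    change 0 - coboundary k V (n + i) θ ⟨l, hl'⟩ = _
    ring
  · have hbl : Suspension.b ∉ l := by
      cases l with
      | nil => simp
      | cons z l =>
        intro h
        rcases List.mem_cons.1 h with h | h
        · exact hb h.symm
        · exact hb (hV.le_b ((List.pairwise_cons.1 hl.1.2.1).1 _ h).le)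
    rw [hnot, IncidenceData.cochainFunctional_single_of_notMem, mul_zero]
    · rintro ⟨j, rfl⟩
      exact hbl List.mem_cons_self
    · exact Finsupp.supported_mono (fun l' h1 (h2 : Suspension.b ∈ l') => hbl (h1.1.subset h2))
        (listBoundary_single_mem k l)

end

theorem nil_mem_belowFamily {V : Type u} [PartialOrder (Suspension V)] {z : Suspension V} (hz : z ≤ Suspension.a) :
    [] ∈ (belowFamily V).lists 0 z :=
  ⟨⟨rfl, List.Pairwise.nil, by simp⟩, hz⟩

/-! ### Ext between the modules at the two new vertices -/

section

variable {k : Type u} [Field k] {V : Type u} [PartialOrder (Suspension V)]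
  [Fintype (Suspension V)] [DecidableEq (Suspension V)] {R : Type u} [Ring R] [Algebra k R]
  (D : IncidenceData k R (Suspension V)) (χ : R →+* k)

/-- The augmentation of the resolution by lists, with values in the one-dimensional module
at `a`. -/
noncomputable def topAugmentation (ha : ∀ z : Suspension V, Suspension.a ≤ z → z = Suspension.a)
    (hχ : ∀ r, χ r = D.ρ r Suspension.a Suspension.a) :
    (belowFamily V).rep D 0 →ₗ[R] (ModuleCat.restrictScalars χ).obj (ModuleCat.of k k) where
  toFun f := f.1 Suspension.a []
  map_add' f g := rfl
  map_smul' r f := by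
    change (∑ w, D.ρ r Suspension.a w • f.1 w) [] = χ r * f.1 Suspension.a []
    -- As `a` is maximal, row `a` of the matrix has no entry off the diagonal.
    rw [Finset.sum_eq_single Suspension.a, hχ]
    · rfl
    · intro w _ hw
      rw [D.ρ_apply_of_not_le r (fun h => hw (ha w h)), zero_smul]
    · simp

variable (ha : ∀ z : Suspension V, Suspension.a ≤ z → z = Suspension.a)
  (hχ : ∀ r, χ r = D.ρ r Suspension.a Suspension.a)

theorem topAugmentation_surjective : Function.Surjective (topAugmentation D χ ha hχ) := by
  intro (c : k)
  refine ⟨IncidenceData.Rep.delta D _ Suspension.a (c • Finsupp.single [] 1)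
    (Submodule.smul_mem _ c (Finsupp.single_mem_supported k 1 (nil_mem_belowFamily le_rfl))), ?_⟩
  change (if (Suspension.a : Suspension V) = Suspension.a then
    c • Finsupp.single ([] : List (Suspension V)) (1 : k) else 0) [] = c
  simp

/-- Below `a` the interval `[z, a)` has a least element, so even the empty list is a boundary. At
`a` only the empty list exists, and its coefficient is the augmentation. -/
theorem exact_topAugmentation :
    Function.Exact ((belowFamily V).d D 0) (topAugmentation D χ ha hχ) := by
  intro f
  constructor
  · intro hf
    have h (z : Suspension V) : ∃ g ∈ Finsupp.supported k k ((belowFamily V).lists 1 z),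
        listBoundary k g = f.1 z := by
      have hfz := f.2 z
      by_cases hz : z ≤ Suspension.a
      · rcases lt_or_eq_of_le hz with hz' | rfl
        · have hU : z ∈ (belowFamily V).U := hz
          simp only [(belowFamily V).mem_supported_iff hU] at hfz ⊢
          refine exists_listBoundary_eq (isLeast_Ico hz') hfz ?_
          have h0 : (f.1 z).support ⊆ {[]} := fun l hl =>
            Finset.mem_singleton.2 (List.length_eq_zero_iff.1 (hfz hl).1)
          obtain ⟨c, hc⟩ := Finsupp.support_subset_singleton'.1 h0
          have h1 : f.1 z = c • Finsupp.single [] 1 := by rw [hc]; simp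
          exact (congrArg (listBoundary k) h1).trans
            (by rw [map_smul, listBoundary_single_nil, smul_zero])
        · refine ⟨0, zero_mem _, ?_⟩
          rw [map_zero]
          refine Finsupp.ext fun l => ?_
          by_cases hl : l = []
          · subst hl
            exact (hf : f.1 Suspension.a [] = 0).symm
          · by_contra hne
            exact hl (List.length_eq_zero_iff.1
              (hfz (Finsupp.mem_support_iff.2 (Ne.symm hne))).1.1)
      · have h0 := (belowFamily V).eq_zero_of_notMem (k := k) (z := z) hz hfz
        exact ⟨0, zero_mem _, (map_zero _).trans h0.symm⟩
    choose g hg hgf using h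
    exact ⟨⟨g, hg⟩, IncidenceData.Rep.ext hgf⟩
  · rintro ⟨g, rfl⟩
    have hg : g.1 Suspension.a = 0 := by
      have h1 := g.2 Suspension.a
      have h2 : (belowFamily V).lists 1 Suspension.a = ∅ := by
        refine Set.eq_empty_of_forall_notMem fun l hl => ?_
        cases l with
        | nil => simpa using hl.1.1
        | cons x l =>
          have := hl.1.2.2 x List.mem_cons_self
          exact (this.1.trans_lt this.2).false
      dsimp only at h1
      rw [h2, Finsupp.supported_empty, Submodule.mem_bot] at h1
      exact h1
    change listBoundary k (g.1 Suspension.a) [] = 0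
    exact (congrArg (fun h => listBoundary k h []) hg).trans (by simp)

/-- The representation of the lower set `{b}` is the one-dimensional module at `b`. -/
noncomputable def repToBottom (hχ : ∀ r, χ r = D.ρ r Suspension.b Suspension.b)
    (hb : ∀ z : Suspension V, z ≤ Suspension.b → z = Suspension.b) :
    D.Rep (IncidenceData.antitone_indicator (k := k) (LowerSet.Iic Suspension.b)) →ₗ[R]
      (ModuleCat.restrictScalars χ).obj (ModuleCat.of k k) where
  toFun f := f.1 Suspension.b
  map_add' f g := rfl
  map_smul' r f := by
    change (∑ w, D.ρ r Suspension.b w • f.1 w) = χ r * f.1 Suspension.b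
    rw [Finset.sum_eq_single Suspension.b, hχ]
    · rfl
    · intro w _ hw
      have := f.2 w
      rw [IncidenceData.indicator_of_notMem fun h => hw (hb w h), Submodule.mem_bot] at this
      exact (congrArg (D.ρ r Suspension.b w • ·) this).trans (smul_zero _)
    · simp

theorem repToBottom_bijective (hχ : ∀ r, χ r = D.ρ r Suspension.b Suspension.b)
    (hb : ∀ z : Suspension V, z ≤ Suspension.b → z = Suspension.b) :
    Function.Bijective (repToBottom D χ hχ hb) := by
  constructor
  · intro f g h
    refine IncidenceData.Rep.ext fun z => ?_
    by_cases hz : z = Suspension.b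
    · subst hz
      exact h
    · have h1 := f.2 z
      have h2 := g.2 z
      rw [IncidenceData.indicator_of_notMem fun h => hz (hb z h), Submodule.mem_bot] at h1 h2
      exact h1.trans h2.symm
  · intro (c : k)
    refine ⟨IncidenceData.Rep.delta D _ Suspension.b c ?_, if_pos rfl⟩
    rw [IncidenceData.indicator_of_mem (show Suspension.b ∈ LowerSet.Iic Suspension.b from le_rfl)]
    trivial

/-- The extensions of the one-dimensional modules at the two new vertices of a suspension are given
by the cohomology of the order complex. -/
theorem nonempty_orderCohomology_equiv_ext [PartialOrder V] (hV : IsSuspensionOrder V)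
    (D : IncidenceData k R (Suspension V)) (χa χb : R →+* k)
    (hχa : ∀ r, χa r = D.ρ r Suspension.a Suspension.a)
    (hχb : ∀ r, χb r = D.ρ r Suspension.b Suspension.b) (n : ℕ) :
    Nonempty (OrderCohomology k V n ≃ₗ[k]
      Abelian.Ext ((ModuleCat.restrictScalars.{u} χa).obj (ModuleCat.of k k))
        ((ModuleCat.restrictScalars.{u} χb).obj (ModuleCat.of k k)) (n + 2 + 1)) := by
  -- Lists start at length `0`, so degree `n + 2 + i` has lists of length `n + i + 2`; those
  -- starting with `b` are `b` followed by the `n + i + 1` entries of an `(n + i)`-simplex.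
  have hidx (i : ℕ) : 0 + (n + 2 + i) = n + i + 2 := by omega
  refine (belowFamily V).nonempty_ext_linearEquiv D 0 (listHead V)
    (fun _ _ _ _ hl => mem_belowFamily_lists_iff hl)
    (topAugmentation D χa (fun _ => hV.a_le) hχa) (topAugmentation_surjective D χa _ hχa)
    (exact_topAugmentation D χa _ hχa)
    (LinearEquiv.ofBijective _ (repToBottom_bijective D χb hχb fun _ => hV.le_b)) (n + 2)
    (J := fun i => Simplex V (n + i)) (fun i j => suspendList j.1)
    (fun i => suspendList_injective.comp Subtype.val_injective) ?_ ?_ ?_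
    (fun i => coboundary k V (n + i)) (-1) (by norm_num) ?_
  · intro i j
    rw [hidx]
    exact ⟨_, suspendList_mem hV j.2⟩
  · exact fun i j z h => (h.1.2.2 _ List.mem_cons_self).1
  · intro i l z hl ht
    rw [hidx] at hl
    obtain ⟨l', hl', rfl⟩ := exists_suspendList_eq hV hl (hV.le_b ht)
    exact ⟨⟨l', hl'⟩, rfl⟩
  · intro i θ z hz l hl
    obtain rfl := hV.le_b hz
    rw [hidx] at hl
    exact cochainFunctional_suspendList hV n i θ hl

end

theorem mainTheorem3 (k : Type u) [Field k] (V : Type u) [Quiver.{u} V] [Finite V]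
    [IsOrderedQuiver V] (n : ℕ) (hn : 1 ≤ n) :
    Nonempty
      (HochschildCohomology k (QuiverIncidenceAlgebra k V)
          (regularBimodule k (QuiverIncidenceAlgebra k V)) n ≃ₗ[k]
        Abelian.Ext (simpleModule k (Suspension.a : Suspension V))
          (simpleModule k (Suspension.b : Suspension V)) (n + 2)) := by
  classical
  -- With `n + 1` in place of `n`, both groups are compared with the order cohomology in degree `n +
  -- 1`, the Ext group being in degree `n + 3`.
  obtain ⟨n, rfl⟩ := Nat.exists_eq_add_of_le' hn
  let := Fintype.ofFinite V
  let := Fintype.ofFinite (Suspension V)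
  let := pathOrder V
  let := pathOrder (Suspension V)
  let D := quiverIncidenceData k (V := V) fun _ _ => Iff.rfl
  let D' := quiverIncidenceData k (V := Suspension V) fun _ _ => Iff.rfl
  obtain ⟨e'⟩ := nonempty_orderCohomology_equiv_ext (k := k) (isSuspensionOrder_pathOrder V) D'
    (incidenceCharacter k Suspension.a).toRingHom (incidenceCharacter k Suspension.b).toRingHom
    (incidenceCharacter_eq k _) (incidenceCharacter_eq k _) n
  obtain ⟨e⟩ := nonempty_orderCohomology_equiv_hochschild D n
  exact ⟨e.symm ≪≫ₗ e'⟩
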